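/- Let $p\ge 1$, $0<\alpha_1<\dots<\alpha_p$ and $S=S_{\alpha_1,\dots,\alpha_p}:=\{n_0+n_1\alpha_1+\dots+n_p\alpha_p : n_0,\dots,n_p\in\mathbb N\}$, where $\mathbb N=\{0,1,2,\dots\}$, and let $c>0$ be a constant such that $\#(S\cap[n,n+1))\le c^{\,n+1}$ for all $n\in\mathbb N$. Powers are principal values; $\mathbb C_-:=\{z\in\mathbb C:\operatorname{Im}z<0\}$. A probability measure $\mu$ on $\mathbb R$ belongs to $\mathcal P_S$ if there are $a_\beta\in\mathbb C$ ($\beta\in S$, $\beta>0$) and $r,R>0$ such that $|a_\beta|\le r^\beta$, $r<c^{-1}R$ and $$\mu|_{\{|x|\ge R\}}(dx)=\sum_{\beta\in S,\ \beta>0}\operatorname{Im}\Big(a_\beta\big(\tfrac1x\big)^{\beta+1}\Big)\,dx,$$ where $(\tfrac1x)^{\beta+1}:=e^{i(\beta+1)\pi}|x|^{-\beta-1}$ for $x<0$. Let $G_\mu(z)=\int_{\mathbb R}\frac{1}{z-x}\,\mu(dx)$ and $F_\mu=1/G_\mu$ on $\mathbb C_-$, and for $\eta,M>0$ let $\Gamma_{\eta,M}=\{z\in\mathbb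 C_-:\operatorname{Im}z<-M,\ \operatorname{Im}z<-\eta|\operatorname{Re}z|\}$. The function $F_\mu$ is injective on some $\Gamma_{\eta',M'}$, and the inverse $F_\mu^{-1}$ of the restriction of $F_\mu$ to $\Gamma_{\eta',M'}$ is defined on some $\Gamma_{\eta,M}$. The Voiculescu transform is $\phi_\mu(z)=F_\mu^{-1}(z)-z$ on $\Gamma_{\eta,M}$, and the same symbol denotes its analytic continuation to a domain of the form $\{z\in\mathbb C_-:|z|>\rho\}$, when that exists. Then, for every probability measure $\mu$ on $\mathbb R$, the following are equivalent. (1) $\mu\in\mathcal P_S$. (2) There exist $(e_\gamma)_{\gamma\in S}\subset\mathbb C$ and $A>0$ such that $|e_\gamma|\le A^{\gamma+1}$ for all $\gamma\in S$ and $$\phi_\mu(z)=z\sum_{\gamma\in S}\frac{e_\gamma}{z^{\gamma}}\qquad\text{on } \{z\in\mathbb C_-:|z|>cA\}.$$ -/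

import Mathlib

open MeasureTheory Set

noncomputable section

namespace PowerSeriesTail

/-- The additive semigroup `{n₀ + n₁ α₁ + ⋯ + n_p α_p : n₀, …, n_p ∈ ℕ}`. -/
def genSemigroup {p : ℕ} (α : Fin p → ℝ) : Set ℝ :=
  {γ | ∃ (n₀ : ℕ) (n : Fin p → ℕ), γ = (n₀ : ℝ) + ∑ i, (n i : ℝ) * α i}

/-- `c > 0` satisfies `#(S ∩ [n, n + 1)) ≤ c ^ (n + 1)` for every natural number `n`. -/
def IsGrowthConstant (S : Set ℝ) (c : ℝ) : Prop :=
  0 < c ∧ ∀ n : ℕ, (S ∩ Ico (n : ℝ) (n + 1)).Finite ∧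
    ((S ∩ Ico (n : ℝ) (n + 1)).ncard : ℝ) ≤ c ^ (n + 1)

/-- The function `x ↦ ∑_{β ∈ S, β > 0} Im (a_β (1 / x) ^ (β + 1))`. For `x < 0` the principal
complex power used by Mathlib gives `(1 / x) ^ (β + 1) = exp (i (β + 1) π) |x| ^ (-β - 1)`,
since the argument of a negative real number is `π`. -/
def tailDensity (S : Set ℝ) (a : ℝ → ℂ) (x : ℝ) : ℝ :=
  ∑' β : {β : ℝ // β ∈ S ∧ 0 < β},
    (a β * (((1 / x : ℝ) : ℂ) ^ (((β : ℝ) + 1 : ℝ) : ℂ))).im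

/-- The class `𝒫_S`, where `c` is a growth constant of `S`: the restriction of `μ` to
`{|x| ≥ R}` is `tailDensity S a x dx` with `|a_β| ≤ r ^ β` and `r < c⁻¹ R`. (The density has to be
nonnegative almost everywhere there because `μ` is a positive measure; this is recorded since
`ENNReal.ofReal` would cut off negative values.) -/
def MemP (S : Set ℝ) (c : ℝ) (μ : Measure ℝ) : Prop :=
  ∃ (a : ℝ → ℂ) (r R : ℝ), 0 < r ∧ 0 < R ∧
    (∀ β ∈ S, 0 < β → ‖a β‖ ≤ r ^ β) ∧
    r < c⁻¹ * R ∧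
    (∀ᵐ x ∂(volume.restrict {x : ℝ | R ≤ |x|}), 0 ≤ tailDensity S a x) ∧
    μ.restrict {x : ℝ | R ≤ |x|} =
      (volume.restrict {x : ℝ | R ≤ |x|}).withDensity
        (fun x => ENNReal.ofReal (tailDensity S a x))

/-- The Cauchy–Stieltjes transform `G_μ(z) = ∫ 1 / (z - x) μ(dx)`. -/
def cauchyTransform (μ : Measure ℝ) (z : ℂ) : ℂ :=
  ∫ x : ℝ, 1 / (z - (x : ℂ)) ∂μ

/-- The reciprocal Cauchy transform `F_μ = 1 / G_μ`. -/
def reciprocalCauchy (μ : Measure ℝ) (z : ℂ) : ℂ :=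
  1 / cauchyTransform μ z

/-- The truncated cone `Γ_{η, M}` in the lower half-plane. -/
def truncatedCone (η M : ℝ) : Set ℂ :=
  {z | z.im < -M ∧ z.im < -(η * |z.re|)}

/-- `φ` is the Voiculescu transform of `μ` on `U ⊆ ℂ`: it is holomorphic on `U`, and on some
truncated cone inside `U` it equals `F_μ⁻¹(z) - z`, where `F_μ⁻¹` is the inverse of the restriction
of `F_μ` to a truncated cone on which `F_μ` is injective. Two choices of the cones give
inverses that agree far out on the negative imaginary axis, so `φ` is unique on `U` when `U` is
open and connected; it is the analytic continuation to `U` of `F_μ⁻¹(z) - z`. -/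
def IsVoiculescuTransform (μ : Measure ℝ) (U : Set ℂ) (φ : ℂ → ℂ) : Prop :=
  DifferentiableOn ℂ φ U ∧
    ∃ η M η' M' : ℝ, 0 < η ∧ 0 < M ∧ 0 < η' ∧ 0 < M' ∧
      truncatedCone η M ⊆ U ∧
      InjOn (reciprocalCauchy μ) (truncatedCone η' M') ∧
      ∀ z ∈ truncatedCone η M,
        z + φ z ∈ truncatedCone η' M' ∧ reciprocalCauchy μ (z + φ z) = z

/-- The part `{z ∈ ℂ₋ : |z| > ρ}` of the lower half-plane. -/
def lowerOutside (ρ : ℝ) : Set ℂ :=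
  {z | z.im < 0 ∧ ρ < ‖z‖}

end PowerSeriesTail

end

/-! Put `z = exp w`, with `w` in the half-strip `-π < Im w < 0`, `Re w` large. If `a` lists the
generators `1, α₁, …, α_p` of `S`, then each power `z ^ (-γ)` with `γ ∈ S` is a monomial in the
numbers `s i = exp (-a i * w)`, and the point `s` tends to `0` as `Re w → ∞`. A series in the powers
`z ^ (-γ)` with geometrically bounded coefficients is therefore the same thing as an ordinary
holomorphic germ at `0` in several variables, evaluated at `s` (`exists_coeff_of_analyticAt`,
`exists_analyticAt_of_coeff`). Both conditions of the theorem turn out to be equivalent to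
`HasCauchyGerm`: `z * G_μ(z)` equals such a germ at `s`, with value `1` at `0`.

Density and Cauchy germ. The tail density is the imaginary part of a function `h` holomorphic beyond
the cut-off. Writing `Im h = (h - conj h) / 2i` and closing the contour in the lower half-plane, the
residue of the `h` part gives `π h`, while the conjugate part sees a pole-free region. What remains
is an integral over `|x| < R` and two arc integrals, all analytic in `1 / z`, hence in the
coordinate belonging to the generator `1` (`cauchyTransform_eq_of_tail`, `hasCauchyGerm_of_memP`).
Conversely, a germ extends `G_μ` continuously to the real axis away from a compact set, and
Stieltjes inversion reads off the density `Im G_μ / π` (`memP_of_hasCauchyGerm`).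

Cauchy germ and Voiculescu transform. If `F(e ^ w) = e ^ w * E(s)`, then looking for the inverse as
`e ^ (w + u)` leads to `e ^ u * E(s i * e ^ (-a i * u)) = 1`, because shifting `w` by `u` only
rescales the coordinates of `s`. The implicit function theorem gives `u = U(s)` with `U` a germ
(`exists_analyticAt_inversion`). The same equation inverts `z + φ(z)` to recover `F`.

The growth constant matters beyond its positivity only from density to germ, where it gives
convergence on a half-plane reaching past the contour. In the other steps `R` or `A` may simply be
taken large. -/

noncomputable section

namespace PowerSeriesTail

open Filter Topology ComplexConjugate

/-! ### Dirichlet-type series over the semigroup as holomorphic germs at the origin. -/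

section Words

variable {ι : Type*}

/-- Finite words over the alphabet `ι`, i.e. noncommutative monomials. -/
abbrev Word (ι : Type*) := Σ n : ℕ, (Fin n → ι)

/-- The sum of the weights of the letters of a word. -/
def wordWeight (a : ι → ℝ) (ω : Word ι) : ℝ := ∑ j, a (ω.2 j)

/-- The product of the coordinates of `s` along a word. -/
def wordMonomial (s : ι → ℂ) (ω : Word ι) : ℂ := ∏ j, s (ω.2 j)

/-- The point `(exp (-a i * w))ᵢ`. -/
def expPoint (a : ι → ℝ) (w : ℂ) : ι → ℂ := fun i => Complex.exp (-(a i : ℂ) * w)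

theorem wordMonomial_expPoint (a : ι → ℝ) (w : ℂ) (ω : Word ι) :
    wordMonomial (expPoint a w) ω = Complex.exp (-(wordWeight a ω : ℂ) * w) := by
  simp only [wordMonomial, expPoint, wordWeight, ← Complex.exp_sum]
  congr 1
  push_cast
  rw [← Finset.sum_neg_distrib, Finset.sum_mul]

theorem eq_empty_of_wordWeight_eq_zero {a : ι → ℝ} (ha : ∀ i, 0 < a i) {ω : Word ι}
    (h : wordWeight a ω = 0) : ω = ⟨0, Fin.elim0⟩ := by
  obtain ⟨n, f⟩ := ω
  rcases Nat.eq_zero_or_pos n with rfl | hn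
  · congr; ext j; exact j.elim0
  · have : 0 < wordWeight a ⟨n, f⟩ :=
      Finset.sum_pos (fun j _ => ha _) ⟨⟨0, hn⟩, Finset.mem_univ _⟩
    exact absurd h this.ne'

theorem tendsto_expPoint {a : ι → ℝ} (ha : ∀ i, 0 < a i) :
    Tendsto (expPoint a) (comap Complex.re atTop) (𝓝 0) := by
  rw [tendsto_pi_nhds]
  intro i
  rw [Pi.zero_apply, tendsto_zero_iff_norm_tendsto_zero]
  have : (fun w : ℂ => ‖expPoint a w i‖) = (fun x : ℝ => Real.exp (-(a i * x))) ∘ Complex.re := by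
    ext w; simp [expPoint, Complex.norm_exp]
  rw [this]
  exact (Real.tendsto_exp_neg_atTop_nhds_zero.comp
    (tendsto_id.const_mul_atTop (ha i))).comp tendsto_comap

theorem eventually_re_iff {P : ℂ → Prop} :
    (∀ᶠ w in comap Complex.re atTop, P w) ↔ ∃ L : ℝ, ∀ w : ℂ, L < w.re → P w := by
  rw [(atTop_basis_Ioi.comap Complex.re).eventually_iff]
  simp

variable [Fintype ι]

/-- The additive semigroup generated by the reals `a i`. -/
def natSpan (a : ι → ℝ) : Set ℝ :=
  {γ | ∃ n : ι → ℕ, γ = ∑ i, (n i : ℝ) * a i}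

theorem wordWeight_mem_natSpan (a : ι → ℝ) (ω : Word ι) : wordWeight a ω ∈ natSpan a := by
  classical
  refine ⟨fun i => (Finset.univ.filter fun j => ω.2 j = i).card, ?_⟩
  rw [wordWeight, ← Finset.sum_fiberwise (s := Finset.univ) (g := ω.2)]
  refine Finset.sum_congr rfl fun i _ => ?_
  rw [Finset.sum_congr rfl (g := fun _ => a i) (by intro j hj; simp at hj; rw [hj])]
  simp

theorem exists_word_of_mem_natSpan {a : ι → ℝ} {γ : ℝ} (hγ : γ ∈ natSpan a) :
    ∃ ω : Word ι, wordWeight a ω = γ := by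
  let W : AddSubmonoid ℝ :=
    { carrier := {γ | ∃ ω : Word ι, wordWeight a ω = γ}
      zero_mem' := ⟨⟨0, Fin.elim0⟩, by simp [wordWeight]⟩
      add_mem' := by
        rintro _ _ ⟨⟨m, f⟩, rfl⟩ ⟨⟨n, g⟩, rfl⟩
        exact ⟨⟨m + n, Fin.append f g⟩, by simp [wordWeight, Fin.sum_univ_add]⟩ }
  obtain ⟨n, rfl⟩ := hγ
  have : ∑ i, (n i : ℝ) * a i ∈ W := by
    refine sum_mem fun i _ => ?_
    rw [← nsmul_eq_mul]
    exact nsmul_mem (show a i ∈ W from ⟨⟨1, fun _ => i⟩, by simp [wordWeight]⟩) _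
  exact this

theorem natSpan_nonneg {a : ι → ℝ} (ha : ∀ i, 0 < a i) {γ : ℝ} (hγ : γ ∈ natSpan a) : 0 ≤ γ := by
  obtain ⟨n, rfl⟩ := hγ
  exact Finset.sum_nonneg fun i _ => mul_nonneg (Nat.cast_nonneg _) (ha i).le

theorem zero_mem_natSpan (a : ι → ℝ) : (0 : ℝ) ∈ natSpan a := ⟨fun _ => 0, by simp⟩

theorem summable_word {b : Word ι → ℝ} {d : ℕ → ℝ} (hb : ∀ ω, 0 ≤ b ω) (hbd : ∀ ω, b ω ≤ d ω.1)
    (hd : Summable fun n => (Fintype.card ι : ℝ) ^ n * d n) : Summable b := by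
  classical
  rw [summable_sigma_of_nonneg hb]
  refine ⟨fun n => (hasSum_fintype _).summable, ?_⟩
  refine Summable.of_nonneg_of_le (fun n => tsum_nonneg fun _ => hb _) (fun n => ?_) hd
  rw [tsum_fintype]
  refine (Finset.sum_le_sum fun f _ => hbd ⟨n, f⟩).trans ?_
  simp

/-- Each multilinear term expands over the standard basis into one summand per word. Keeping words
noncommutative avoids any multinomial bookkeeping. -/
theorem hasSum_word_of_hasFPowerSeriesAt [DecidableEq ι] {V : (ι → ℂ) → ℂ}
    {p : FormalMultilinearSeries ℂ (ι → ℂ) ℂ} (hV : HasFPowerSeriesAt V p 0) :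
    ∃ ρ : ℝ, 0 < ρ ∧
      Summable (fun ω : Word ι => ‖p ω.1 fun j => Pi.single (ω.2 j) (1 : ℂ)‖ * ρ ^ ω.1) ∧
      ∀ s : ι → ℂ, ‖s‖ ≤ ρ →
        HasSum (fun ω : Word ι => (p ω.1 fun j => Pi.single (ω.2 j) (1 : ℂ)) * wordMonomial s ω)
          (V s) := by
  obtain ⟨r, hr⟩ := hV
  obtain ⟨q, hq0, hqr⟩ := ENNReal.lt_iff_exists_nnreal_btwn.1 hr.r_pos
  have hq0' : 0 < q := by exact_mod_cast hq0
  set N : ℝ := Nat.cast (Fintype.card ι) with hN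
  have hN0 : 0 ≤ N := Nat.cast_nonneg _
  -- There are `N ^ n` words of length `n`; shrinking the radius by `N + 1` absorbs this count and
  -- also covers an empty alphabet.
  set ρ : ℝ := q / (N + 1) with hρ
  have hρ0 : 0 < ρ := by have : (0 : ℝ) < q := hq0'; positivity
  have hρq : ρ ≤ q := by
    rw [hρ]; exact div_le_self hq0'.le (by linarith)
  have hNρ : N * ρ ≤ q := by
    rw [hρ, mul_div_assoc', div_le_iff₀ (by positivity)]
    nlinarith [q.2]
  have hnorm : ∀ ω : Word ι, ‖p ω.1 fun j => Pi.single (ω.2 j) (1 : ℂ)‖ ≤ ‖p ω.1‖ := fun ω => by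
    have h := (p ω.1).le_opNorm fun j => Pi.single (ω.2 j) (1 : ℂ)
    have h1 : ∀ i : ι, ‖(Pi.single i (1 : ℂ) : ι → ℂ)‖ = 1 := fun i => by
      rw [Pi.norm_single, norm_one]
    simpa only [h1, Finset.prod_const_one, mul_one] using h
  have hsum : Summable fun ω : Word ι =>
      ‖p ω.1 fun j => Pi.single (ω.2 j) (1 : ℂ)‖ * ρ ^ ω.1 := by
    refine summable_word (d := fun n => ‖p n‖ * ρ ^ n) (fun ω => by positivity)
      (fun ω => by gcongr; exact hnorm ω) ?_
    refine Summable.of_nonneg_of_le (fun n => by positivity) (fun n => ?_)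
      (p.summable_norm_mul_pow (hqr.trans_le hr.r_le))
    calc N ^ n * (‖p n‖ * ρ ^ n) = ‖p n‖ * (N * ρ) ^ n := by rw [mul_pow]; ring
      _ ≤ _ := by gcongr
  refine ⟨ρ, hρ0, hsum, fun s hs => ?_⟩
  have hmono : ∀ ω : Word ι, ‖wordMonomial s ω‖ ≤ ρ ^ ω.1 := fun ω => by
    rw [wordMonomial, norm_prod]
    refine (Finset.prod_le_prod (fun _ _ => norm_nonneg _)
      (fun j _ => (norm_le_pi_norm s _).trans hs)).trans ?_
    simp
  have hS : Summable fun ω : Word ι =>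
      (p ω.1 fun j => Pi.single (ω.2 j) (1 : ℂ)) * wordMonomial s ω :=
    Summable.of_norm_bounded hsum fun ω => by
      rw [norm_mul]; gcongr; exact hmono ω
  have hterm : ∀ n, (∑' f : Fin n → ι, (p n fun j => Pi.single (f j) (1 : ℂ)) *
      wordMonomial s ⟨n, f⟩) = p n fun _ => s := fun n => by
    rw [tsum_fintype]
    have h1 : s = ∑ i, s i • (Pi.single i (1 : ℂ) : ι → ℂ) := by
      ext k; simp [Finset.sum_apply, Pi.single_apply]
    conv_rhs => rw [h1, (p n).map_sum]
    refine Finset.sum_congr rfl fun f _ => ?_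
    rw [(p n).map_smul_univ, smul_eq_mul, mul_comm]
    rfl
  have hball : s ∈ Metric.eball (0 : ι → ℂ) r := by
    rw [Metric.mem_eball, edist_zero_right]
    refine lt_of_le_of_lt ?_ hqr
    rw [enorm_eq_nnnorm]
    exact_mod_cast hs.trans hρq
  have h2 := hr.hasSum hball
  rw [zero_add] at h2
  have h3 := hS.hasSum.sigma fun n => (hS.sigma_factor n).hasSum
  simp only [hterm] at h3
  rw [← h3.unique h2]
  exact hS.hasSum

/-- Summing coordinate monomials over the words of length `n` gives a multilinear map of norm at
most `C * (N * K) ^ n`, so the formal series has positive radius. Evaluating it on basis vectors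
returns exactly `c`, which reduces the expansion to the preceding lemma. -/
theorem exists_analyticAt_hasSum_word (c : Word ι → ℂ) (C K : ℝ) (hc : ∀ ω, ‖c ω‖ ≤ C * K ^ ω.1)
    (hK : 0 < K) :
    ∃ V : (ι → ℂ) → ℂ, AnalyticAt ℂ V 0 ∧ V 0 = c ⟨0, Fin.elim0⟩ ∧
      ∃ ρ : ℝ, 0 < ρ ∧ ∀ s : ι → ℂ, ‖s‖ ≤ ρ →
        HasSum (fun ω : Word ι => c ω * wordMonomial s ω) (V s) := by
  classical
  let p : FormalMultilinearSeries ℂ (ι → ℂ) ℂ := fun n =>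
    ∑ f : Fin n → ι, c ⟨n, f⟩ • (ContinuousMultilinearMap.mkPiAlgebra ℂ (Fin n) ℂ).compContinuousLinearMap
      (fun j => ContinuousLinearMap.proj (R := ℂ) (φ := fun _ : ι => ℂ) (f j))
  set N : ℝ := Nat.cast (Fintype.card ι) with hN
  have hN0 : 0 ≤ N := Nat.cast_nonneg _
  have hC : 0 ≤ C := by
    have := (norm_nonneg _).trans (hc ⟨0, Fin.elim0⟩)
    simpa using this
  have hp : ∀ n, ‖p n‖ ≤ C * (N * K) ^ n := fun n => by
    refine (norm_sum_le _ _).trans ?_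
    calc _ ≤ ∑ f : Fin n → ι, C * K ^ n := Finset.sum_le_sum fun f _ => by
          rw [norm_smul]
          refine (mul_le_mul (hc ⟨n, f⟩) (?_ : _ ≤ (1 : ℝ)) (norm_nonneg _) (by positivity)).trans
            (mul_one _).le
          refine ContinuousMultilinearMap.opNorm_le_bound zero_le_one fun m => ?_
          simp only [ContinuousMultilinearMap.compContinuousLinearMap_apply,
            ContinuousMultilinearMap.mkPiAlgebra_apply, ContinuousLinearMap.proj_apply, norm_prod,
            one_mul]
          exact Finset.prod_le_prod (fun _ _ => norm_nonneg _) fun j _ => norm_le_pi_norm (m j) _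
      _ = _ := by simp [mul_pow, hN]; ring
  have hpos : 0 < p.radius := by
    obtain ⟨q, hq⟩ : ∃ q : NNReal, (q : ℝ) = (N * K + 1)⁻¹ :=
      ⟨⟨(N * K + 1)⁻¹, by positivity⟩, rfl⟩
    have h : (q : ENNReal) ≤ p.radius := by
      refine p.le_radius_of_bound C fun n => ?_
      refine (mul_le_mul_of_nonneg_right (hp n) (by positivity)).trans ?_
      rw [mul_assoc, ← mul_pow]
      refine mul_le_of_le_one_right hC (pow_le_one₀ (by positivity) ?_)
      rw [hq, mul_inv_le_iff₀ (by positivity)]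
      linarith
    refine lt_of_lt_of_le ?_ h
    rw [ENNReal.coe_pos, ← NNReal.coe_pos, hq]
    positivity
  have hV : HasFPowerSeriesAt p.sum p 0 := (p.hasFPowerSeriesOnBall hpos).hasFPowerSeriesAt
  have hcoef : ∀ ω : Word ι, (p ω.1 fun j => Pi.single (ω.2 j) (1 : ℂ)) = c ω := fun ω => by
    simp only [p, sum_apply, smul_apply,
      ContinuousMultilinearMap.compContinuousLinearMap_apply,
      ContinuousMultilinearMap.mkPiAlgebra_apply, ContinuousLinearMap.proj_apply, smul_eq_mul]
    rw [Finset.sum_eq_single ω.2]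
    · simp
    · intro g _ hg
      obtain ⟨j, hj⟩ := Function.ne_iff.1 hg
      rw [Finset.prod_eq_zero (Finset.mem_univ j), mul_zero]
      rw [Pi.single_apply, if_neg hj]
    · simp
  obtain ⟨ρ, hρ, -, h⟩ := hasSum_word_of_hasFPowerSeriesAt hV
  refine ⟨p.sum, hV.analyticAt, ?_, ρ, hρ, fun s hs => ?_⟩
  · rw [← hV.coeff_zero Fin.elim0, ← hcoef ⟨0, Fin.elim0⟩]
    congr 1; ext j; exact j.elim0
  · simpa only [hcoef] using h s hs

/-- A function holomorphic near `0`, evaluated at `expPoint a w`, is a generalized Dirichlet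
series over `natSpan a` with geometrically bounded coefficients. -/
theorem exists_coeff_of_analyticAt {a : ι → ℝ} (ha : ∀ i, 0 < a i) {V : (ι → ℂ) → ℂ}
    (hV : AnalyticAt ℂ V 0) :
    ∃ (f : ℝ → ℂ) (C B : ℝ), 0 < C ∧ 0 < B ∧ (∀ γ ∈ natSpan a, ‖f γ‖ ≤ C * B ^ γ) ∧ f 0 = V 0 ∧
      ∀ᶠ w in comap Complex.re atTop,
        HasSum (fun γ : natSpan a => f γ * Complex.exp (-((γ : ℝ) : ℂ) * w)) (V (expPoint a w)) := by
  classical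
  obtain ⟨p, hp⟩ := hV
  obtain ⟨ρ, hρ, hsum, hs⟩ := hasSum_word_of_hasFPowerSeriesAt hp
  set c : Word ι → ℂ := fun ω => p ω.1 fun j => Pi.single (ω.2 j) (1 : ℂ) with hcdef
  have hev : ∀ᶠ w in comap Complex.re atTop, ‖expPoint a w‖ ≤ ρ := by
    have := (tendsto_expPoint ha).norm
    rw [norm_zero] at this
    exact this.eventually_le_const hρ
  obtain ⟨L, hL⟩ := eventually_re_iff.1 hev
  set g : Word ι → natSpan a := fun ω => ⟨wordWeight a ω, wordWeight_mem_natSpan a ω⟩ with hg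
  -- Several words may have the same weight, through reordering or rational relations among the `a
  -- i`, so their coefficients are collected on each fibre.
  let f : ℝ → ℂ := fun γ => ∑' ω : {ω : Word ι // wordWeight a ω = γ}, c ω
  -- Absolute convergence at this single real point bounds every fibre sum by a constant times `exp
  -- X ^ γ`.
  set X : ℝ := L + 1
  have hX : ∀ ω, ‖c ω‖ * Real.exp (-(wordWeight a ω * X)) ≤ ‖c ω‖ * ρ ^ ω.1 := fun ω => by
    gcongr
    have h1 : Real.exp (-(wordWeight a ω * X)) = ‖wordMonomial (expPoint a (X : ℂ)) ω‖ := by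
      rw [wordMonomial_expPoint, Complex.norm_exp]; simp
    rw [h1, wordMonomial, norm_prod]
    refine (Finset.prod_le_prod (fun _ _ => norm_nonneg _)
      (fun j _ => (norm_le_pi_norm _ _).trans (hL X (by simp [X])))).trans ?_
    simp
  have hsX : Summable fun ω => ‖c ω‖ * Real.exp (-(wordWeight a ω * X)) :=
    Summable.of_nonneg_of_le (fun ω => by positivity) hX hsum
  refine ⟨f, (∑' ω, ‖c ω‖ * Real.exp (-(wordWeight a ω * X))) + 1, Real.exp X, ?_,
    Real.exp_pos _, ?_, ?_, ?_⟩
  · have : 0 ≤ ∑' ω, ‖c ω‖ * Real.exp (-(wordWeight a ω * X)) :=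
      tsum_nonneg fun ω => by positivity
    linarith
  · intro γ _
    have hfib : Summable fun ω : {ω : Word ι // wordWeight a ω = γ} =>
        ‖c ω‖ * Real.exp (-(wordWeight a ω * X)) := hsX.subtype _
    have heq : ∀ ω : {ω : Word ι // wordWeight a ω = γ},
        ‖c ω‖ = Real.exp X ^ γ * (‖c ω‖ * Real.exp (-(wordWeight a ω * X))) := fun ω => by
      rw [ω.2, ← Real.exp_mul, mul_left_comm, ← Real.exp_add]
      rw [show X * γ + -(γ * X) = 0 by ring, Real.exp_zero, mul_one]
    have hsc : Summable fun ω : {ω : Word ι // wordWeight a ω = γ} => ‖c ω‖ := by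
      exact (hfib.mul_left (Real.exp X ^ γ)).congr fun ω => (heq ω).symm
    calc ‖f γ‖ ≤ ∑' ω : {ω : Word ι // wordWeight a ω = γ}, ‖c ω‖ := norm_tsum_le_tsum_norm hsc
      _ = Real.exp X ^ γ * ∑' ω : {ω : Word ι // wordWeight a ω = γ},
          (‖c ω‖ * Real.exp (-(wordWeight a ω * X))) := by
        rw [← tsum_mul_left]; exact tsum_congr heq
      _ ≤ Real.exp X ^ γ * ((∑' ω, ‖c ω‖ * Real.exp (-(wordWeight a ω * X))) + 1) := by
        gcongr
        refine (hsX.tsum_subtype_le _ {ω | wordWeight a ω = γ} fun ω => by positivity).trans ?_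
        linarith
      _ = _ := mul_comm _ _
  · have huniq : ∀ ω : {ω : Word ι // wordWeight a ω = 0}, ω = ⟨⟨0, Fin.elim0⟩, by simp [wordWeight]⟩ :=
      fun ω => Subtype.ext (eq_empty_of_wordWeight_eq_zero ha ω.2)
    show ∑' ω : {ω : Word ι // wordWeight a ω = 0}, c ω = V 0
    rw [tsum_eq_single _ fun ω h => absurd (huniq ω) h, hcdef]
    exact hp.coeff_zero _
  · refine eventually_re_iff.2 ⟨L, fun w hw => ?_⟩
    have h := (hs _ (hL w hw)).tsum_fiberwise g
    refine (congrArg (fun u => HasSum u (V (expPoint a w))) (funext fun γ => ?_)).mp h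
    have hpre : g ⁻¹' {γ} = {ω | wordWeight a ω = γ.1} := by
      ext ω; simp [hg, Subtype.ext_iff]
    rw [hpre, ← tsum_mul_right]
    refine tsum_congr fun ω => ?_
    rw [wordMonomial_expPoint, ω.2]

/-- A generalized Dirichlet series over `natSpan a` with geometrically bounded coefficients comes
from a function holomorphic near `0`. -/
theorem exists_analyticAt_of_coeff {a : ι → ℝ} (ha : ∀ i, 0 < a i) {e : ℝ → ℂ} {C B : ℝ}
    (hB : 0 < B) (he : ∀ γ ∈ natSpan a, ‖e γ‖ ≤ C * B ^ γ) :
    ∃ V : (ι → ℂ) → ℂ, AnalyticAt ℂ V 0 ∧ V 0 = e 0 ∧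
      ∀ᶠ w in comap Complex.re atTop,
        HasSum (fun γ : natSpan a => e γ * Complex.exp (-((γ : ℝ) : ℂ) * w)) (V (expPoint a w)) := by
  classical
  -- One word is selected for each exponent. The germ obtained depends on the selection, but its
  -- values at `expPoint a w` do not.
  choose ω hω using fun γ : natSpan a => exists_word_of_mem_natSpan γ.2
  have hinj : Function.Injective ω := fun x y h => Subtype.ext (by rw [← hω x, ← hω y, h])
  let c : Word ι → ℂ := fun v => if v ∈ range ω then e (wordWeight a v) else 0
  have hC : 0 ≤ C := by
    have := (norm_nonneg _).trans (he 0 (zero_mem_natSpan a))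
    simpa using this
  -- A word of length `n` has weight at most `n * ∑ a i`; with the base raised to at least `1`, a
  -- bound in the weight becomes a bound in the length.
  set K : ℝ := (max B 1) ^ (∑ i, a i)
  have hcK : ∀ v, ‖c v‖ ≤ C * K ^ v.1 := fun v => by
    by_cases hv : v ∈ range ω
    · simp only [c, if_pos hv]
      refine (he _ (wordWeight_mem_natSpan a v)).trans ?_
      gcongr
      rw [← Real.rpow_natCast, ← Real.rpow_mul (by positivity)]
      have hw : wordWeight a v ≤ (∑ i, a i) * v.1 := by
        refine (Finset.sum_le_sum fun j _ => Finset.single_le_sum (f := a)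
          (fun i _ => (ha i).le) (Finset.mem_univ (v.2 j))).trans ?_
        simp [mul_comm]
      refine (Real.rpow_le_rpow hB.le (le_max_left B 1)
        (natSpan_nonneg ha (wordWeight_mem_natSpan a v))).trans ?_
      exact Real.rpow_le_rpow_of_exponent_le (le_max_right _ _) hw
    · simp only [c, if_neg hv, norm_zero]
      positivity
  obtain ⟨V, hV, hV0, ρ, hρ, hs⟩ := exists_analyticAt_hasSum_word c C K hcK (by positivity)
  refine ⟨V, hV, ?_, ?_⟩
  · have h0 : ω ⟨0, zero_mem_natSpan a⟩ = ⟨0, Fin.elim0⟩ :=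
      eq_empty_of_wordWeight_eq_zero ha (hω _)
    rw [hV0, ← h0]
    simp only [c, if_pos (mem_range_self _), hω]
  · have := (tendsto_expPoint ha).norm
    rw [norm_zero] at this
    filter_upwards [this.eventually_le_const hρ] with w hw
    have h := hs _ hw
    rw [← hinj.hasSum_iff] at h
    · convert h using 2 with γ
      simp only [Function.comp, c, if_pos (mem_range_self _), wordMonomial_expPoint, hω]
    · intro v hv
      simp only [c, if_neg hv, zero_mul]

end Words

/-! ### Inversion by the implicit function theorem. -/

/-- Implicit solution `u = U s` of `exp u * E (s * exp (-a * u)) = 1` near the origin. -/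
theorem exists_analyticAt_inversion {ι : Type*} [Fintype ι] (a : ι → ℝ) {E : (ι → ℂ) → ℂ}
    (hE : AnalyticAt ℂ E 0) (hE0 : E 0 = 1) :
    ∃ U : (ι → ℂ) → ℂ, AnalyticAt ℂ U 0 ∧ U 0 = 0 ∧
      ∀ᶠ v : (ι → ℂ) × ℂ in 𝓝 (0, 0),
        (Complex.exp v.2 * E (fun i => v.1 i * Complex.exp (-(a i : ℂ) * v.2)) = 1 ↔
          U v.1 = v.2) := by
  let Ψ : (ι → ℂ) × ℂ → ℂ := fun v =>
    Complex.exp v.2 * E (fun i => v.1 i * Complex.exp (-(a i : ℂ) * v.2))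
  have hin : AnalyticAt ℂ (fun v : (ι → ℂ) × ℂ => fun i => v.1 i * Complex.exp (-(a i : ℂ) * v.2))
      (0, 0) := by
    rw [analyticAt_pi_iff]
    intro i
    have h1 : AnalyticAt ℂ (fun v : (ι → ℂ) × ℂ => v.1 i) (0, 0) :=
      ((ContinuousLinearMap.proj (R := ℂ) (φ := fun _ : ι => ℂ) i).comp
        (ContinuousLinearMap.fst ℂ (ι → ℂ) ℂ)).analyticAt _
    exact h1.mul (AnalyticAt.cexp (analyticAt_const.mul analyticAt_snd))
  have hΨ : AnalyticAt ℂ Ψ (0, 0) := by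
    refine (AnalyticAt.cexp analyticAt_snd).mul ?_
    refine AnalyticAt.fun_comp (g := E) ?_ hin
    have h0 : (fun i => ((0 : ι → ℂ), (0 : ℂ)).1 i *
        Complex.exp (-(a i : ℂ) * ((0 : ι → ℂ), (0 : ℂ)).2)) = 0 := by ext i; simp
    rwa [h0]
  have hΨ0 : Ψ (0, 0) = 1 := by
    have : (fun i => (0 : ι → ℂ) i * Complex.exp (-(a i : ℂ) * 0)) = 0 := by ext i; simp
    simp only [Ψ, this, hE0]; simp
  -- Here `⊤` is the analytic class, not `C^∞`; this is what makes the implicit function analytic.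
  have hcd : ContDiffAt ℂ (⊤ : WithTop ℕ∞) Ψ (0, 0) := hΨ.contDiffAt
  -- On `s = 0` the map `Ψ` is `exp`, since `E 0 = 1`; hence its `u`-derivative at the origin is
  -- `1`.
  have hpart : fderiv ℂ Ψ (0, 0) ∘L .inr ℂ (ι → ℂ) ℂ = ContinuousLinearMap.id ℂ ℂ := by
    have h1 : HasFDerivAt (fun u : ℂ => Ψ (0, u)) (fderiv ℂ Ψ (0, 0) ∘L .inr ℂ (ι → ℂ) ℂ) 0 :=
      HasFDerivAt.comp (0 : ℂ) (g := Ψ) (f := fun u : ℂ => ((0 : ι → ℂ), u))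
        hΨ.differentiableAt.hasFDerivAt (hasFDerivAt_prodMk_right _ _)
    have h2 : (fun u : ℂ => Ψ (0, u)) = Complex.exp := by
      ext u
      have : (fun i => (0 : ι → ℂ) i * Complex.exp (-(a i : ℂ) * u)) = 0 := by ext i; simp
      simp only [Ψ, this, hE0, mul_one]
    rw [h2] at h1
    rw [h1.unique (Complex.hasDerivAt_exp 0).hasFDerivAt]
    ext
    simp
  have hinv : (fderiv ℂ Ψ (0, 0) ∘L .inr ℂ (ι → ℂ) ℂ).IsInvertible := by
    rw [hpart]; exact ⟨ContinuousLinearEquiv.refl ℂ ℂ, rfl⟩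
  refine ⟨hcd.implicitFunction (by simp) hinv, ?_,
    hcd.implicitFunction_apply_self (by simp) hinv, ?_⟩
  · exact analyticWithinAt_univ.1 (contDiffWithinAt_omega_iff_analyticWithinAt.1
      (hcd.contDiffAt_implicitFunction (by simp) hinv).contDiffWithinAt)
  · filter_upwards [hcd.eventually_apply_eq_iff_implicitFunction (by simp) hinv] with v hv
    rw [hΨ0] at hv
    exact hv

theorem expPoint_add {ι : Type*} (a : ι → ℝ) (w u : ℂ) :
    expPoint a (w + u) = fun i => expPoint a w i * Complex.exp (-(a i : ℂ) * u) := by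
  ext i; simp only [expPoint, ← Complex.exp_add, mul_add]

/-! ### Cauchy transforms in the lower half-plane. -/

/-- For small `t` the denominator stays at least `1 / 2` in modulus, which justifies differentiating
under the integral. With `t = 1 / z` this covers the integral over bounded `x` and the arc
integrals. -/
theorem analyticAt_integral_div_one_sub {X : Type*} [MeasurableSpace X] (ν : Measure X)
    [IsFiniteMeasure ν] {u v : X → ℂ} {R C : ℝ} (hu : AEStronglyMeasurable u ν)
    (hv : AEStronglyMeasurable v ν) (huR : ∀ᵐ x ∂ν, ‖u x‖ ≤ R) (hvC : ∀ᵐ x ∂ν, ‖v x‖ ≤ C)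
    (hR : 0 ≤ R) (hC : 0 ≤ C) :
    AnalyticAt ℂ (fun t : ℂ => ∫ x, v x / (1 - t * u x) ∂ν) 0 := by
  set δ : ℝ := (2 * (R + 1))⁻¹ with hδ
  have hδ0 : 0 < δ := by positivity
  have hlow : ∀ t ∈ Metric.ball (0 : ℂ) δ, ∀ x, ‖u x‖ ≤ R → 1 / 2 ≤ ‖1 - t * u x‖ := by
    intro t ht x hx
    rw [mem_ball_zero_iff] at ht
    have h1 : ‖t * u x‖ ≤ 1 / 2 := by
      rw [norm_mul]
      calc ‖t‖ * ‖u x‖ ≤ δ * (R + 1) := by gcongr; linarith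
        _ = 1 / 2 := by rw [hδ]; field_simp
    have h2 := norm_sub_norm_le (1 : ℂ) (t * u x)
    rw [norm_one] at h2
    linarith
  have hd : DifferentiableOn ℂ (fun t : ℂ => ∫ x, v x / (1 - t * u x) ∂ν)
      (Metric.ball (0 : ℂ) δ) := by
    intro t₀ ht₀
    have hmeas : ∀ t : ℂ, AEStronglyMeasurable (fun x => v x / (1 - t * u x)) ν := fun t =>
      (hv.aemeasurable.div (aemeasurable_const.sub
        (hu.aemeasurable.const_mul t))).aestronglyMeasurable
    refine (hasDerivAt_integral_of_dominated_loc_of_deriv_le (μ := ν)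
      (F := fun t x => v x / (1 - t * u x))
      (F' := fun t x => v x * u x / (1 - t * u x) ^ 2) (x₀ := t₀) (s := Metric.ball (0 : ℂ) δ)
      (bound := fun _ => C * R / (1 / 2) ^ 2)
      (Metric.isOpen_ball.mem_nhds ht₀) (Eventually.of_forall hmeas) ?_ ?_ ?_
      (integrable_const _) ?_).2.differentiableAt.differentiableWithinAt
    · refine Integrable.of_bound (hmeas t₀) (C / (1 / 2)) ?_
      filter_upwards [huR, hvC] with x hx hx'
      rw [norm_div]
      gcongr
      exact hlow _ ht₀ x hx
    · exact ((hv.aemeasurable.mul hu.aemeasurable).div ((aemeasurable_const.sub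
        (hu.aemeasurable.const_mul t₀)).pow_const 2)).aestronglyMeasurable
    · filter_upwards [huR, hvC] with x hx hx' t ht
      rw [norm_div, norm_mul, norm_pow]
      have := hlow _ ht x hx
      gcongr
    · filter_upwards [huR] with x hx t ht
      have h0 : (1 - t * u x) ≠ 0 := by
        have := hlow _ ht x hx
        intro h; rw [h, norm_zero] at this; norm_num at this
      have h1 : HasDerivAt (fun t : ℂ => 1 - t * u x) (-u x) t := by
        simpa using ((hasDerivAt_id t).mul_const (u x)).const_sub 1
      exact ((hasDerivAt_const t (v x)).div h1 h0).congr_deriv (by ring)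
  exact hd.analyticAt (Metric.ball_mem_nhds _ hδ0)

theorem norm_sub_ofReal_ge (z : ℂ) (x : ℝ) : -z.im ≤ ‖z - x‖ := by
  have h := Complex.abs_im_le_norm (z - x)
  simp only [Complex.sub_im, Complex.ofReal_im, sub_zero] at h
  exact (neg_le_abs _).trans h

theorem sub_ofReal_ne_zero {z : ℂ} (hz : z.im < 0) (x : ℝ) : z - x ≠ 0 := by
  intro h
  have := norm_sub_ofReal_ge z x
  rw [h, norm_zero] at this
  linarith

theorem norm_inv_sub_ofReal_le {z : ℂ} (hz : z.im < 0) (x : ℝ) :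
    ‖1 / (z - x)‖ ≤ 1 / (-z.im) := by
  rw [norm_div, norm_one]
  exact one_div_le_one_div_of_le (by linarith) (norm_sub_ofReal_ge z x)

theorem measurable_inv_sub_ofReal (z : ℂ) : Measurable fun x : ℝ => 1 / (z - (x : ℂ)) :=
  measurable_const.div (measurable_const.sub Complex.measurable_ofReal)

theorem integrable_inv_sub_ofReal (μ : Measure ℝ) [IsFiniteMeasure μ] {z : ℂ} (hz : z.im < 0) :
    Integrable (fun x : ℝ => 1 / (z - (x : ℂ))) μ :=
  Integrable.of_bound (measurable_inv_sub_ofReal z).aestronglyMeasurable _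
    (Eventually.of_forall fun x => norm_inv_sub_ofReal_le hz x)

/-- Dividing `z - x` by `z₀ - x` gives `1 + (z - z₀) / (z₀ - x)`, so the previous lemma applies with
`t = z - z₀`. -/
theorem analyticAt_cauchyTransform (μ : Measure ℝ) [IsFiniteMeasure μ] {z₀ : ℂ}
    (hz₀ : z₀.im < 0) : AnalyticAt ℂ (cauchyTransform μ) z₀ := by
  have hm : AEStronglyMeasurable (fun x : ℝ => 1 / (z₀ - (x : ℂ))) μ :=
    (measurable_inv_sub_ofReal z₀).aestronglyMeasurable
  have h := analyticAt_integral_div_one_sub μ (u := fun x : ℝ => -(1 / (z₀ - (x : ℂ))))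
    (v := fun x : ℝ => 1 / (z₀ - (x : ℂ))) (R := 1 / (-z₀.im)) (C := 1 / (-z₀.im)) hm.neg hm
    (Eventually.of_forall fun x => by rw [norm_neg]; exact norm_inv_sub_ofReal_le hz₀ x)
    (Eventually.of_forall fun x => norm_inv_sub_ofReal_le hz₀ x)
    (by have : 0 < -z₀.im := by linarith
        positivity)
    (by have : 0 < -z₀.im := by linarith
        positivity)
  have h1 : AnalyticAt ℂ (fun z : ℂ => ∫ x : ℝ, 1 / (z₀ - (x : ℂ)) /
      (1 - (z - z₀) * -(1 / (z₀ - (x : ℂ)))) ∂μ) z₀ := by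
    refine AnalyticAt.fun_comp (g := fun t : ℂ => ∫ x : ℝ, 1 / (z₀ - (x : ℂ)) /
      (1 - t * -(1 / (z₀ - (x : ℂ)))) ∂μ) (f := fun z => z - z₀) ?_
      (analyticAt_id.sub analyticAt_const)
    simpa using h
  refine h1.congr ?_
  filter_upwards [(isOpen_lt Complex.continuous_im continuous_const).mem_nhds hz₀] with z hz
  refine integral_congr_ae (Eventually.of_forall fun x => ?_)
  have h2 := sub_ofReal_ne_zero hz x
  have h3 := sub_ofReal_ne_zero hz₀ x
  have h4 : 1 - (z - z₀) * -(1 / (z₀ - (x : ℂ))) = (z - x) / (z₀ - x) := by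
    field_simp; ring
  simp only [h4]
  field_simp

theorem im_inv_sub_ofReal (z : ℂ) (x : ℝ) :
    (1 / (z - (x : ℂ))).im = -z.im / ‖z - x‖ ^ 2 := by
  rw [one_div, Complex.inv_im, Complex.normSq_eq_norm_sq]
  simp

theorem im_cauchyTransform (μ : Measure ℝ) [IsFiniteMeasure μ] {z : ℂ} (hz : z.im < 0) :
    (cauchyTransform μ z).im = ∫ x : ℝ, -z.im / ‖z - x‖ ^ 2 ∂μ := by
  simp only [← im_inv_sub_ofReal]
  exact (integral_im (𝕜 := ℂ) (integrable_inv_sub_ofReal μ hz)).symm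

/-- Some interval `[-n, n]` carries half of the mass, and on it the Poisson kernel is bounded below.
The quantitative form later forces points where the transform is small, at height below a fixed
`-M'`, to be large. -/
theorem exists_le_im_cauchyTransform (μ : Measure ℝ) [IsProbabilityMeasure μ] :
    ∃ K : ℝ, 0 < K ∧ ∀ z : ℂ, z.im < 0 →
      -z.im / (2 * (‖z‖ + K) ^ 2) ≤ (cauchyTransform μ z).im := by
  have hlim : Tendsto (fun n : ℕ => μ (Icc (-(n : ℝ)) n)) atTop (𝓝 (μ (⋃ n : ℕ, Icc (-(n : ℝ)) n))) :=
    tendsto_measure_iUnion_atTop fun m n h => Icc_subset_Icc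
      (neg_le_neg (Nat.cast_le.2 h)) (Nat.cast_le.2 h)
  have hU : (⋃ n : ℕ, Icc (-(n : ℝ)) n) = univ := by
    refine eq_univ_of_forall fun x => ?_
    obtain ⟨n, hn⟩ := exists_nat_ge |x|
    exact mem_iUnion.2 ⟨n, abs_le.1 hn⟩
  rw [hU, measure_univ] at hlim
  obtain ⟨n, hn, hn1⟩ := ((hlim.eventually_const_le
    (show (ENNReal.ofReal (1 / 2) : ENNReal) < 1 by
      rw [← ENNReal.ofReal_one]; exact (ENNReal.ofReal_lt_ofReal_iff one_pos).2 (by norm_num))).and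
    (eventually_gt_atTop 0)).exists
  have hn0 : (0 : ℝ) < n := by exact_mod_cast hn1
  have hreal : 1 / 2 ≤ μ.real (Icc (-(n : ℝ)) n) :=
    (ENNReal.ofReal_le_iff_le_toReal (measure_ne_top _ _)).1 hn
  refine ⟨n, hn0, fun z hz => ?_⟩
  rw [im_cauchyTransform μ hz]
  have hint : Integrable (fun x : ℝ => -z.im / ‖z - x‖ ^ 2) μ := by
    simp only [← im_inv_sub_ofReal]
    exact (integrable_inv_sub_ofReal μ hz).im
  have hz' : 0 < -z.im := by linarith
  calc -z.im / (2 * (‖z‖ + n) ^ 2) = 1 / 2 * (-z.im / (‖z‖ + n) ^ 2) := by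
        rw [mul_comm 2 _, ← div_div]; ring
    _ ≤ μ.real (Icc (-(n : ℝ)) n) * (-z.im / (‖z‖ + n) ^ 2) := by gcongr
    _ = ∫ x in Icc (-(n : ℝ)) n, -z.im / (‖z‖ + n) ^ 2 ∂μ := by
        rw [setIntegral_const, smul_eq_mul]
    _ ≤ ∫ x in Icc (-(n : ℝ)) n, -z.im / ‖z - x‖ ^ 2 ∂μ := by
        refine setIntegral_mono_on (integrable_const _) hint.integrableOn measurableSet_Icc ?_
        intro x hx
        have h1 : 0 < ‖z - x‖ := norm_pos_iff.2 (sub_ofReal_ne_zero hz x)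
        gcongr
        refine (norm_sub_le _ _).trans ?_
        gcongr
        rw [Complex.norm_real]
        exact abs_le.2 hx
    _ ≤ ∫ x : ℝ, -z.im / ‖z - x‖ ^ 2 ∂μ :=
        setIntegral_le_integral hint (Eventually.of_forall fun x => by
          simp only [Pi.zero_apply]; positivity)

theorem im_cauchyTransform_pos (μ : Measure ℝ) [IsProbabilityMeasure μ] {z : ℂ} (hz : z.im < 0) :
    0 < (cauchyTransform μ z).im := by
  obtain ⟨K, hK, h⟩ := exists_le_im_cauchyTransform μ
  refine lt_of_lt_of_le ?_ (h z hz)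
  have hz' : 0 < -z.im := by linarith
  positivity

/-- In a cone `|z / (z - x)|` is at most `1 / η + 1` uniformly in `x`, so dominated convergence
applies. -/
theorem tendsto_mul_cauchyTransform (μ : Measure ℝ) [IsProbabilityMeasure μ] {η : ℝ} (hη : 0 < η) :
    Tendsto (fun z => z * cauchyTransform μ z)
      (comap norm atTop ⊓ 𝓟 {z : ℂ | z.im < -(η * |z.re|)}) (𝓝 1) := by
  have hlt : ∀ z ∈ {z : ℂ | z.im < -(η * |z.re|)}, z.im < 0 := fun z hz =>
    lt_of_lt_of_le hz (by simp; positivity)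
  have heq : ∀ z : ℂ, z * cauchyTransform μ z = ∫ x : ℝ, z * (1 / (z - (x : ℂ))) ∂μ := fun z =>
    (integral_const_mul _ _).symm
  simp only [heq]
  have h1 : (∫ _ : ℝ, (1 : ℂ) ∂μ) = 1 := by simp
  refine (congrArg (fun c : ℂ => Tendsto (fun z : ℂ => ∫ x : ℝ, z * (1 / (z - (x : ℂ))) ∂μ)
    (comap norm atTop ⊓ 𝓟 {z : ℂ | z.im < -(η * |z.re|)}) (𝓝 c)) h1).mp ?_
  refine tendsto_integral_filter_of_dominated_convergence (fun _ => 1 / η + 1)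
    (Eventually.of_forall fun z =>
      ((measurable_inv_sub_ofReal z).const_mul z).aestronglyMeasurable) ?_ (integrable_const _)
    (Eventually.of_forall fun x => ?_)
  · filter_upwards [mem_inf_of_right (mem_principal_self _)] with z hz
    refine Eventually.of_forall fun x => ?_
    have hz0 := hlt z hz
    rw [norm_mul]
    refine (mul_le_mul_of_nonneg_left (norm_inv_sub_ofReal_le hz0 x) (norm_nonneg _)).trans ?_
    rw [mul_one_div, div_le_iff₀ (by linarith)]
    have h2 : |z.re| ≤ 1 / η * -z.im := by
      rw [one_div, ← div_eq_inv_mul, le_div_iff₀ hη]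
      have : z.im < -(η * |z.re|) := hz
      linarith
    have h3 := Complex.norm_le_abs_re_add_abs_im z
    rw [abs_of_neg hz0] at h3
    linarith
  · have hinv : Tendsto (fun z : ℂ => z⁻¹) (comap norm atTop) (𝓝 0) := by
      rw [comap_norm_atTop]; exact tendsto_inv₀_cobounded
    have h2 : Tendsto (fun z : ℂ => (1 - x * z⁻¹)⁻¹) (comap norm atTop) (𝓝 ((1 - x * 0)⁻¹)) :=
      ((hinv.const_mul _).const_sub _).inv₀ (by simp)
    simp only [mul_zero, sub_zero, inv_one] at h2
    refine (h2.mono_left inf_le_left).congr' ?_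
    filter_upwards [mem_inf_of_right (mem_principal_self _)] with z hz
    have hz0 := hlt z hz
    have h3 := sub_ofReal_ne_zero hz0 x
    have h4 : z ≠ 0 := by rintro rfl; simp at hz0
    have h5 : 1 - x * z⁻¹ = (z - x) / z := by field_simp
    rw [h5]; field_simp

/-! ### Cauchy's integral formula on rectangles. -/

/-- The integral of `f` over the positively oriented boundary of `[a, b] × [c, d]`. -/
def rectIntegral (f : ℂ → ℂ) (a b c d : ℝ) : ℂ :=
  (∫ x in a..b, f (x + c * Complex.I)) - (∫ x in a..b, f (x + d * Complex.I)) +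
    Complex.I * (∫ y in c..d, f (b + y * Complex.I)) -
    Complex.I * ∫ y in c..d, f (a + y * Complex.I)

/-- The boundary of the rectangle `[a, b] × [c, d]`. -/
def rectBoundary (a b c d : ℝ) : Set ℂ :=
  {w | w.re ∈ Icc a b ∧ w.im ∈ Icc c d ∧ (w.re = a ∨ w.re = b ∨ w.im = c ∨ w.im = d)}

theorem rectIntegral_congr {f g : ℂ → ℂ} {a b c d : ℝ} (hab : a ≤ b) (hcd : c ≤ d)
    (h : EqOn f g (rectBoundary a b c d)) : rectIntegral f a b c d = rectIntegral g a b c d := by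
  unfold rectIntegral
  congr 1
  · congr 1
    · congr 1
      · refine intervalIntegral.integral_congr fun x hx => h ?_
        rw [uIcc_of_le hab] at hx
        simp [rectBoundary, hx.1, hx.2, hcd]
      · refine intervalIntegral.integral_congr fun x hx => h ?_
        rw [uIcc_of_le hab] at hx
        simp [rectBoundary, hx.1, hx.2, hcd]
    · congr 1
      refine intervalIntegral.integral_congr fun x hx => h ?_
      rw [uIcc_of_le hcd] at hx
      simp [rectBoundary, hx.1, hx.2, hab]
  · congr 1
    refine intervalIntegral.integral_congr fun x hx => h ?_
    rw [uIcc_of_le hcd] at hx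
    simp [rectBoundary, hx.1, hx.2, hab]

theorem rectIntegral_add {f g : ℂ → ℂ} {a b c d : ℝ} (hab : a ≤ b) (hcd : c ≤ d)
    (hf : ContinuousOn f (rectBoundary a b c d)) (hg : ContinuousOn g (rectBoundary a b c d)) :
    rectIntegral (fun w => f w + g w) a b c d = rectIntegral f a b c d + rectIntegral g a b c d := by
  have hx : ∀ {k : ℂ → ℂ} {e : ℝ}, ContinuousOn k (rectBoundary a b c d) → (e = c ∨ e = d) →
      IntervalIntegrable (fun x : ℝ => k (x + e * Complex.I)) volume a b := by
    intro k e hk he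
    refine ContinuousOn.intervalIntegrable (hk.comp (by fun_prop) fun x hx => ?_)
    rw [uIcc_of_le hab] at hx
    rcases he with rfl | rfl <;> simp [rectBoundary, hx.1, hx.2, hcd]
  have hy : ∀ {k : ℂ → ℂ} {e : ℝ}, ContinuousOn k (rectBoundary a b c d) → (e = a ∨ e = b) →
      IntervalIntegrable (fun y : ℝ => k (e + y * Complex.I)) volume c d := by
    intro k e hk he
    refine ContinuousOn.intervalIntegrable (hk.comp (by fun_prop) fun y hy => ?_)
    rw [uIcc_of_le hcd] at hy
    rcases he with rfl | rfl <;> simp [rectBoundary, hy.1, hy.2, hab]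
  unfold rectIntegral
  rw [intervalIntegral.integral_add (hx hf (.inl rfl)) (hx hg (.inl rfl)),
    intervalIntegral.integral_add (hx hf (.inr rfl)) (hx hg (.inr rfl)),
    intervalIntegral.integral_add (hy hf (.inl rfl)) (hy hg (.inl rfl)),
    intervalIntegral.integral_add (hy hf (.inr rfl)) (hy hg (.inr rfl))]
  ring

theorem rectIntegral_const_mul (k : ℂ) (f : ℂ → ℂ) (a b c d : ℝ) :
    rectIntegral (fun w => k * f w) a b c d = k * rectIntegral f a b c d := by
  simp only [rectIntegral, intervalIntegral.integral_const_mul]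
  ring

theorem rectIntegral_eq_zero {f : ℂ → ℂ} {a b c d : ℝ} (hab : a ≤ b) (hcd : c ≤ d)
    (hf : DifferentiableOn ℂ f (Icc a b ×ℂ Icc c d)) : rectIntegral f a b c d = 0 := by
  have h := Complex.integral_boundary_rect_eq_zero_of_differentiableOn f (⟨a, c⟩ : ℂ) ⟨b, d⟩
    (by simpa [uIcc_of_le hab, uIcc_of_le hcd] using hf)
  simpa [rectIntegral] using h

/-- The factor `κ` rotates the segment into the right half-plane, where the principal logarithm is
an antiderivative. -/
theorem integral_div_eq_log_sub_log {p δ κ : ℂ} {s t : ℝ} (hst : s ≤ t) (hκ : κ ≠ 0)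
    (h : ∀ y ∈ Icc s t, 0 < (κ * (p + y * δ)).re) :
    ∫ y in s..t, δ * (p + y * δ)⁻¹ = Complex.log (κ * (p + t * δ)) - Complex.log (κ * (p + s * δ)) := by
  have hne : ∀ y ∈ Icc s t, p + (y : ℂ) * δ ≠ 0 := fun y hy h0 => by
    have := h y hy; rw [h0] at this; simp at this
  have hd : ∀ y ∈ uIcc s t, HasDerivAt (fun y : ℝ => Complex.log (κ * (p + y * δ)))
      (δ * (p + y * δ)⁻¹) y := by
    intro y hy
    rw [uIcc_of_le hst] at hy
    have h1 : HasDerivAt (fun y : ℝ => κ * (p + y * δ)) (κ * δ) y := by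
      have := ((Complex.ofRealCLM.hasDerivAt (x := y)).mul_const δ).const_add p |>.const_mul κ
      simpa using this
    refine (h1.clog_real (Or.inl (h y hy))).congr_deriv ?_
    have := hne y hy
    field_simp
  refine intervalIntegral.integral_eq_sub_of_hasDerivAt hd (ContinuousOn.intervalIntegrable ?_)
  rw [uIcc_of_le hst]
  exact continuousOn_const.mul (ContinuousOn.inv₀ (by fun_prop) hne)

theorem log_I_mul_sub_log {v : ℂ} (hv : 0 < v.re) :
    Complex.log (Complex.I * v) - Complex.log v = Real.pi / 2 * Complex.I := by
  have h := abs_lt.1 (Complex.abs_arg_lt_pi_div_two_iff.2 (Or.inl hv))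
  have hv0 : v ≠ 0 := by rintro rfl; simp at hv
  have h1 := (Complex.log_mul_eq_add_log_iff Complex.I_ne_zero hv0).2
    (by rw [Complex.arg_I]; constructor <;> linarith [h.1, h.2])
  rw [h1, Complex.log_I]
  ring

/-- Each side is rotated into the right half-plane by a power of `I`. The logarithms used on
adjacent sides differ by `π / 2 * I` at their common corner, and four corners make `2 * π * I`. -/
theorem rectIntegral_inv_sub {w₀ : ℂ} {a b c d : ℝ} (ha : a < w₀.re) (hb : w₀.re < b)
    (hc : c < w₀.im) (hd : w₀.im < d) :
    rectIntegral (fun w => (w - w₀)⁻¹) a b c d = 2 * Real.pi * Complex.I := by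
  have hab : a ≤ b := (ha.trans hb).le
  have hcd : c ≤ d := (hc.trans hd).le
  have hB := integral_div_eq_log_sub_log (p := c * Complex.I - w₀) (δ := 1) (κ := Complex.I) hab
    Complex.I_ne_zero (fun y _ => by simp; linarith)
  have hT := integral_div_eq_log_sub_log (p := d * Complex.I - w₀) (δ := 1) (κ := -Complex.I) hab
    (neg_ne_zero.2 Complex.I_ne_zero) (fun y _ => by simp; linarith)
  have hR := integral_div_eq_log_sub_log (p := b - w₀) (δ := Complex.I) (κ := 1) hcd
    one_ne_zero (fun y _ => by simp; linarith)
  have hL := integral_div_eq_log_sub_log (p := a - w₀) (δ := Complex.I) (κ := -1) hcd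
    (neg_ne_zero.2 one_ne_zero) (fun y _ => by simp; linarith)
  simp only [intervalIntegral.integral_const_mul, one_mul, mul_one] at hB hT hR hL
  have e1 : ∀ x : ℝ, ∀ e : ℝ, (x : ℂ) + e * Complex.I - w₀ = e * Complex.I - w₀ + x :=
    fun x e => by ring
  have e2 : ∀ x : ℝ, ∀ e : ℝ, (e : ℂ) + x * Complex.I - w₀ = e - w₀ + x * Complex.I :=
    fun x e => by ring
  unfold rectIntegral
  simp only [e1 _ c, e1 _ d, e2 _ a, e2 _ b]
  rw [hB, hT, hR, hL]
  have c1 := log_I_mul_sub_log (v := -Complex.I * (d * Complex.I - w₀ + b)) (by simp; linarith)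
  have c2 := log_I_mul_sub_log (v := b - w₀ + c * Complex.I) (by simp; linarith)
  have c3 := log_I_mul_sub_log (v := Complex.I * (c * Complex.I - w₀ + a)) (by simp; linarith)
  have c4 := log_I_mul_sub_log (v := -1 * (a - w₀ + d * Complex.I)) (by simp; linarith)
  rw [show Complex.I * (-Complex.I * (d * Complex.I - w₀ + b)) = b - w₀ + d * Complex.I by
    linear_combination (-(d * Complex.I - w₀ + b)) * Complex.I_mul_I] at c1
  rw [show Complex.I * (b - w₀ + c * Complex.I) = Complex.I * (c * Complex.I - w₀ + b) by
    ring] at c2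
  rw [show Complex.I * (Complex.I * (c * Complex.I - w₀ + a)) = -1 * (a - w₀ + c * Complex.I) by
    linear_combination (c * Complex.I - w₀ + a) * Complex.I_mul_I] at c3
  rw [show Complex.I * (-1 * (a - w₀ + d * Complex.I)) = -Complex.I * (d * Complex.I - w₀ + a) by
    ring] at c4
  linear_combination c1 + c2 + c3 + c4

/-- Subtracting `n w₀ / (w - w₀)` leaves the difference quotient `dslope n w₀`, whose singularity is
removable and whose integral vanishes. -/
theorem rectIntegral_div_sub {n : ℂ → ℂ} {U : Set ℂ} (hU : IsOpen U) (hn : DifferentiableOn ℂ n U)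
    {w₀ : ℂ} {a b c d : ℝ} (hsub : Icc a b ×ℂ Icc c d ⊆ U) (ha : a < w₀.re) (hb : w₀.re < b)
    (hc : c < w₀.im) (hd : w₀.im < d) :
    rectIntegral (fun w => n w / (w - w₀)) a b c d = 2 * Real.pi * Complex.I * n w₀ := by
  have hab : a ≤ b := (ha.trans hb).le
  have hcd : c ≤ d := (hc.trans hd).le
  have hw₀ : w₀ ∈ U := hsub ⟨⟨ha.le, hb.le⟩, ⟨hc.le, hd.le⟩⟩
  have hbd : rectBoundary a b c d ⊆ Icc a b ×ℂ Icc c d := fun w hw => ⟨hw.1, hw.2.1⟩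
  have hne : ∀ w ∈ rectBoundary a b c d, w - w₀ ≠ 0 := by
    rintro w ⟨-, -, h⟩ h0
    rw [sub_eq_zero.1 h0] at h
    rcases h with h | h | h | h <;> linarith
  have hds : DifferentiableOn ℂ (dslope n w₀) U :=
    (Complex.differentiableOn_dslope (hU.mem_nhds hw₀)).2 hn
  have hEq : EqOn (fun w => n w / (w - w₀)) (fun w => dslope n w₀ w + n w₀ * (w - w₀)⁻¹)
      (rectBoundary a b c d) := by
    intro w hw
    have h0 := hne w hw
    have h1 : w ≠ w₀ := fun h => h0 (sub_eq_zero.2 h)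
    simp only [dslope_of_ne _ h1, slope_def_field]
    field_simp
    ring
  have hcinv : ContinuousOn (fun w => n w₀ * (w - w₀)⁻¹) (rectBoundary a b c d) :=
    continuousOn_const.mul (ContinuousOn.inv₀ (by fun_prop) hne)
  rw [rectIntegral_congr hab hcd hEq, rectIntegral_add hab hcd
    (hds.continuousOn.mono (hbd.trans hsub)) hcinv,
    rectIntegral_eq_zero hab hcd (hds.mono hsub), rectIntegral_const_mul,
    rectIntegral_inv_sub ha hb hc hd]
  ring

/-! ### Contour deformation in the logarithmic coordinate. -/

/-- The Cauchy kernel `h(w) dζ / (z - ζ)` in the coordinate `ζ = exp w`. -/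
def expKernel (h : ℂ → ℂ) (z w : ℂ) : ℂ := h w * Complex.exp w / (z - Complex.exp w)

theorem im_exp_nonpos {w : ℂ} (h1 : -Real.pi ≤ w.im) (h2 : w.im ≤ 0) :
    (Complex.exp w).im ≤ 0 := by
  rw [Complex.exp_im]
  have := Real.sin_nonpos_of_nonpos_of_neg_pi_le h2 h1
  nlinarith [Real.exp_pos w.re]

theorem im_exp_neg {w : ℂ} (h1 : -Real.pi < w.im) (h2 : w.im < 0) :
    (Complex.exp w).im < 0 := by
  rw [Complex.exp_im]
  have := Real.sin_neg_of_neg_of_neg_pi_lt h2 h1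
  nlinarith [Real.exp_pos w.re]

/-- `exp` maps the strip `-π ≤ Im w ≤ 0` into the closed lower half-plane, so the kernel has no pole
there. -/
theorem rectIntegral_expKernel_of_im_pos {h : ℂ → ℂ} {ℓ₀ ℓ T : ℝ} (hℓ : ℓ₀ < ℓ) (hT : ℓ ≤ T)
    (hh : DifferentiableOn ℂ h {w | ℓ₀ < w.re}) {z : ℂ} (hz : 0 < z.im) :
    rectIntegral (expKernel h z) ℓ T (-Real.pi) 0 = 0 := by
  refine rectIntegral_eq_zero hT (by linarith [Real.pi_pos]) fun w hw => ?_
  have hre : ℓ ≤ w.re := hw.1.1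
  have him : -Real.pi ≤ w.im ∧ w.im ≤ 0 := hw.2
  have hd : DifferentiableAt ℂ h w :=
    hh.differentiableAt ((isOpen_lt continuous_const Complex.continuous_re).mem_nhds
      (hℓ.trans_le hre))
  refine ((hd.mul Complex.differentiableAt_exp).div
    ((differentiableAt_const z).sub Complex.differentiableAt_exp) ?_).differentiableWithinAt
  intro h0
  have := im_exp_nonpos him.1 him.2
  rw [← sub_eq_zero.1 h0] at this
  linarith

theorem rectIntegral_expKernel_of_im_neg {h : ℂ → ℂ} {ℓ₀ ℓ T : ℝ} (hℓ : ℓ₀ < ℓ)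
    (hh : DifferentiableOn ℂ h {w | ℓ₀ < w.re}) {w₀ : ℂ} (h1 : ℓ < w₀.re) (h2 : w₀.re < T)
    (h3 : -Real.pi < w₀.im) (h4 : w₀.im < 0) :
    rectIntegral (expKernel h (Complex.exp w₀)) ℓ T (-Real.pi) 0 =
      -(2 * Real.pi * Complex.I * h w₀) := by
  -- Factoring `exp w - exp w₀ = m w * (w - w₀)` isolates the pole. The factor `m` has no zero
  -- within vertical distance `2 * π` of `w₀`, and `m w₀ = exp w₀` cancels the Jacobian.
  set m : ℂ → ℂ := dslope Complex.exp w₀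
  let U : Set ℂ := {w | ℓ₀ < w.re ∧ |w.im - w₀.im| < 2 * Real.pi}
  have hUo : IsOpen U :=
    (isOpen_lt continuous_const Complex.continuous_re).inter
      (isOpen_lt (Complex.continuous_im.sub continuous_const).abs continuous_const)
  have hw₀U : w₀ ∈ U := ⟨hℓ.trans h1, by simp [Real.pi_pos]⟩
  have hmw₀ : m w₀ = Complex.exp w₀ := by
    simp only [m, dslope_same, Complex.deriv_exp]
  have hm : ∀ w ∈ U, m w ≠ 0 := by
    intro w hw h0
    by_cases hww : w = w₀
    · rw [hww, hmw₀] at h0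
      exact Complex.exp_ne_zero _ h0
    · simp only [m, dslope_of_ne _ hww, slope_def_field, div_eq_zero_iff, sub_eq_zero, hww,
        or_false] at h0
      obtain ⟨k, hk⟩ := Complex.exp_eq_exp_iff_exists_int.1 h0
      have him : w.im - w₀.im = k * (2 * Real.pi) := by rw [hk]; simp
      have h5 := hw.2
      rw [him, abs_mul, abs_of_pos (by positivity : (0 : ℝ) < 2 * Real.pi)] at h5
      have h6 : |(k : ℝ)| < 1 := by
        by_contra hcon
        push Not at hcon
        nlinarith [Real.pi_pos]
      have h7 : k = 0 := by
        rw [← Int.cast_abs] at h6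
        exact Int.abs_lt_one_iff.1 (by exact_mod_cast h6)
      rw [h7] at hk
      exact hww (by simpa using hk)
  have hmd : DifferentiableOn ℂ m U :=
    (Complex.differentiableOn_dslope (hUo.mem_nhds hw₀U)).2 Complex.differentiable_exp.differentiableOn
  have hn : DifferentiableOn ℂ (fun w => h w * Complex.exp w / m w) U :=
    ((hh.mono fun w hw => hw.1).mul Complex.differentiable_exp.differentiableOn).div hmd hm
  have hsub : Icc ℓ T ×ℂ Icc (-Real.pi) 0 ⊆ U := by
    rintro w ⟨⟨hw1, hw2⟩, ⟨hw3, hw4⟩⟩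
    exact ⟨hℓ.trans_le hw1, by rw [abs_lt]; constructor <;> linarith⟩
  have hres := rectIntegral_div_sub hUo hn hsub h1 h2 h3 h4
  have hEq : EqOn (expKernel h (Complex.exp w₀))
      (fun w => (-1) * (h w * Complex.exp w / m w / (w - w₀))) (rectBoundary ℓ T (-Real.pi) 0) := by
    rintro w ⟨hw1, hw2, hw⟩
    have hww : w ≠ w₀ := by
      rintro rfl
      rcases hw with h | h | h | h <;> linarith
    have h5 := hm w (hsub ⟨hw1, hw2⟩)
    have h6 : w - w₀ ≠ 0 := sub_ne_zero.2 hww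
    have h7 : Complex.exp w₀ - Complex.exp w = -(m w * (w - w₀)) := by
      simp only [m, dslope_of_ne _ hww, slope_def_field]
      field_simp
      ring
    simp only [expKernel, h7]
    field_simp
  rw [rectIntegral_congr (h1.trans h2).le (by linarith [Real.pi_pos]) hEq, rectIntegral_const_mul,
    hres, hmw₀, mul_div_assoc, div_self (Complex.exp_ne_zero _)]
  ring

section Contour

variable {h : ℂ → ℂ} {ℓ₀ ℓ C : ℝ}

/-- The contribution of the half circle of radius `exp ℓ` to the contour integral. -/
def arcIntegral (h : ℂ → ℂ) (ℓ : ℝ) (z : ℂ) : ℂ :=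
  ∫ y in (-Real.pi)..0, expKernel h z (ℓ + y * Complex.I)

/-- The integral of the Cauchy kernel over `exp ℓ ≤ |x| ≤ exp T` on the real line. -/
def lineIntegral (h : ℂ → ℂ) (ℓ T : ℝ) (z : ℂ) : ℂ :=
  ∫ x in ℓ..T, (expKernel h z (x : ℂ) - expKernel h z (x - Real.pi * Complex.I))

/-- The decay of `h` cancels the length factor `exp T`, and the denominator still contributes a
factor of order `exp (-T)`. -/
theorem tendsto_arcIntegral (hb : ∀ w : ℂ, ℓ ≤ w.re → ‖h w‖ ≤ C * Real.exp (-w.re)) (z : ℂ) :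
    Tendsto (fun T : ℝ => arcIntegral h T z) atTop (𝓝 0) := by
  have hlim : Tendsto (fun T : ℝ => C / (Real.exp T - ‖z‖) * |0 - -Real.pi|) atTop (𝓝 0) := by
    have h1 : Tendsto (fun T : ℝ => Real.exp T - ‖z‖) atTop atTop :=
      tendsto_atTop_add_const_right _ _ Real.tendsto_exp_atTop
    have := (h1.const_div_atTop C).mul_const |0 - -Real.pi|
    simpa using this
  refine squeeze_zero_norm' ?_ hlim
  filter_upwards [eventually_ge_atTop ℓ, Real.tendsto_exp_atTop.eventually_gt_atTop ‖z‖] with T hT hz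
  refine intervalIntegral.norm_integral_le_of_norm_le_const fun y _ => ?_
  have hre : ((T : ℂ) + y * Complex.I).re = T := by simp
  have hne : ‖Complex.exp (T + y * Complex.I)‖ = Real.exp T := by rw [Complex.norm_exp, hre]
  have h1 := hb (T + y * Complex.I) (by rw [hre]; exact hT)
  rw [hre] at h1
  have h2 : Real.exp T - ‖z‖ ≤ ‖z - Complex.exp (T + y * Complex.I)‖ := by
    have := norm_sub_norm_le (Complex.exp (T + y * Complex.I)) z
    rwa [hne, norm_sub_rev] at this
  rw [expKernel, norm_div, norm_mul, hne]
  have h3 : 0 < Real.exp T - ‖z‖ := by linarith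
  have h4 : ‖h (T + y * Complex.I)‖ * Real.exp T ≤ C := by
    calc _ ≤ C * Real.exp (-T) * Real.exp T := by gcongr
      _ = C := by rw [mul_assoc, ← Real.exp_add]; simp
  exact div_le_div₀ ((by positivity : (0 : ℝ) ≤ _).trans h4) h4 h3 h2

theorem exp_sub_pi_mul_I (w : ℂ) : Complex.exp (w - Real.pi * Complex.I) = -Complex.exp w := by
  rw [Complex.exp_sub, Complex.exp_pi_mul_I]; ring

theorem continuousOn_expKernel_line (hℓ : ℓ₀ < ℓ) (hh : DifferentiableOn ℂ h {w | ℓ₀ < w.re})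
    {z : ℂ} (hz : z.im ≠ 0) (T : ℝ) :
    ContinuousOn (fun x : ℝ => expKernel h z (x : ℂ)) (Icc ℓ T) ∧
      ContinuousOn (fun x : ℝ => expKernel h z (x - Real.pi * Complex.I)) (Icc ℓ T) := by
  have hden : ∀ r : ℝ, z - r ≠ 0 := fun r h0 => hz (by rw [sub_eq_zero.1 h0]; simp)
  constructor
  · refine ContinuousOn.div ((hh.continuousOn.comp (by fun_prop) fun x hx => ?_).mul (by fun_prop))
      (by fun_prop) fun x _ => ?_
    · simpa using hℓ.trans_le hx.1
    · rw [← Complex.ofReal_exp]; exact hden _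
  · refine ContinuousOn.div ((hh.continuousOn.comp (by fun_prop) fun x hx => ?_).mul (by fun_prop))
      (by fun_prop) fun x _ => ?_
    · simpa using hℓ.trans_le hx.1
    · rw [exp_sub_pi_mul_I, ← Complex.ofReal_exp, ← Complex.ofReal_neg]; exact hden _

theorem lineIntegral_eq (hℓ : ℓ₀ < ℓ) (hh : DifferentiableOn ℂ h {w | ℓ₀ < w.re})
    {z : ℂ} (hz : z.im ≠ 0) {T : ℝ} (hT : ℓ ≤ T) :
    lineIntegral h ℓ T z = -rectIntegral (expKernel h z) ℓ T (-Real.pi) 0 +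
      Complex.I * arcIntegral h T z - Complex.I * arcIntegral h ℓ z := by
  obtain ⟨h1, h2⟩ := continuousOn_expKernel_line hℓ hh hz T
  rw [← uIcc_of_le hT] at h1 h2
  rw [lineIntegral, intervalIntegral.integral_sub h1.intervalIntegrable h2.intervalIntegrable,
    rectIntegral, arcIntegral, arcIntegral]
  simp only [Complex.ofReal_zero, zero_mul, add_zero, Complex.ofReal_neg, neg_mul, ← sub_eq_add_neg]
  ring

theorem tendsto_lineIntegral_of_im_pos (hℓ : ℓ₀ < ℓ)
    (hh : DifferentiableOn ℂ h {w | ℓ₀ < w.re})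
    (hb : ∀ w : ℂ, ℓ ≤ w.re → ‖h w‖ ≤ C * Real.exp (-w.re)) {z : ℂ} (hz : 0 < z.im) :
    Tendsto (fun T => lineIntegral h ℓ T z) atTop (𝓝 (-(Complex.I * arcIntegral h ℓ z))) := by
  have h1 := ((tendsto_arcIntegral hb z).const_mul Complex.I).sub_const
    (Complex.I * arcIntegral h ℓ z)
  rw [mul_zero, zero_sub] at h1
  refine h1.congr' ?_
  filter_upwards [eventually_ge_atTop ℓ] with T hT
  rw [lineIntegral_eq hℓ hh hz.ne' hT, rectIntegral_expKernel_of_im_pos hℓ hT hh hz]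
  ring

theorem tendsto_lineIntegral_of_im_neg (hℓ : ℓ₀ < ℓ)
    (hh : DifferentiableOn ℂ h {w | ℓ₀ < w.re})
    (hb : ∀ w : ℂ, ℓ ≤ w.re → ‖h w‖ ≤ C * Real.exp (-w.re)) {w₀ : ℂ} (h1 : ℓ < w₀.re)
    (h2 : -Real.pi < w₀.im) (h3 : w₀.im < 0) :
    Tendsto (fun T => lineIntegral h ℓ T (Complex.exp w₀)) atTop
      (𝓝 (2 * Real.pi * Complex.I * h w₀ - Complex.I * arcIntegral h ℓ (Complex.exp w₀))) := by
  have h4 := (((tendsto_arcIntegral hb (Complex.exp w₀)).const_mul Complex.I).const_add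
    (2 * Real.pi * Complex.I * h w₀)).sub_const (Complex.I * arcIntegral h ℓ (Complex.exp w₀))
  rw [mul_zero, add_zero] at h4
  refine h4.congr' ?_
  filter_upwards [eventually_gt_atTop w₀.re] with T hT
  rw [lineIntegral_eq hℓ hh (im_exp_neg h2 h3).ne (h1.trans hT).le,
    rectIntegral_expKernel_of_im_neg hℓ hh h1 hT h2 h3]
  ring

/-- `Im h` is not holomorphic, but `(h - conj h) / 2i` separates it into a part with kernel at `z`
and the conjugate of a part with kernel at `conj z`, each accessible to Cauchy's theorem. -/
theorem integral_im_mul_kernel (hℓ : ℓ₀ < ℓ) (hh : DifferentiableOn ℂ h {w | ℓ₀ < w.re})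
    {z : ℂ} (hz : z.im ≠ 0) {T : ℝ} (hT : ℓ ≤ T) :
    ∫ s in ℓ..T, ((((h s).im : ℂ) / (z - Real.exp s) +
      ((h (s - Real.pi * Complex.I)).im : ℂ) / (z + Real.exp s)) * Real.exp s) =
      (lineIntegral h ℓ T z - conj (lineIntegral h ℓ T (conj z))) / (2 * Complex.I) := by
  have hz' : (conj z).im ≠ 0 := by simpa using hz
  have hci : ∀ ζ : ℂ, ζ.im ≠ 0 → IntervalIntegrable
      (fun x : ℝ => expKernel h ζ (x : ℂ) - expKernel h ζ (x - Real.pi * Complex.I)) volume ℓ T := by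
    intro ζ hζ
    obtain ⟨h1, h2⟩ := continuousOn_expKernel_line hℓ hh hζ T
    rw [← uIcc_of_le hT] at h1 h2
    exact (h1.sub h2).intervalIntegrable
  have hconj : conj (lineIntegral h ℓ T (conj z)) = ∫ x in ℓ..T,
      conj (expKernel h (conj z) (x : ℂ) - expKernel h (conj z) (x - Real.pi * Complex.I)) := by
    rw [lineIntegral, intervalIntegral.integral_of_le hT, intervalIntegral.integral_of_le hT,
      ← integral_conj]
  have hci' : IntervalIntegrable (fun x : ℝ =>
      conj (expKernel h (conj z) (x : ℂ) - expKernel h (conj z) (x - Real.pi * Complex.I)))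
      volume ℓ T := by
    obtain ⟨h1, h2⟩ := continuousOn_expKernel_line hℓ hh hz' T
    rw [← uIcc_of_le hT] at h1 h2
    exact (Complex.continuous_conj.comp_continuousOn (h1.sub h2)).intervalIntegrable
  rw [hconj, lineIntegral, ← intervalIntegral.integral_sub (hci z hz) hci', div_eq_mul_inv,
    ← intervalIntegral.integral_mul_const]
  refine intervalIntegral.integral_congr fun s _ => ?_
  have him : ∀ v : ℂ, (v.im : ℂ) = (v - conj v) / (2 * Complex.I) := fun v => by
    rw [Complex.sub_conj]; push_cast; field_simp
  have hden : ∀ r : ℝ, z - r ≠ 0 := fun r h0 => hz (by rw [sub_eq_zero.1 h0]; simp)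
  have hd1 := hden (Real.exp s)
  have hd2 : z + Real.exp s ≠ 0 := by have := hden (-Real.exp s); simpa using this
  simp only [expKernel, exp_sub_pi_mul_I, map_sub, map_add, map_div₀, map_mul, map_neg, Complex.conj_conj,
    ← Complex.ofReal_exp, Complex.conj_ofReal, him, sub_neg_eq_add]
  field_simp
  ring

end Contour

/-- The integral against a measure with a density on `{R ≤ |x|}`, over that set. -/
theorem integral_tail_eq {μ : Measure ℝ} {d : ℝ → ℝ} {R : ℝ}
    (hdm : AEMeasurable d (volume.restrict {x : ℝ | R ≤ |x|}))
    (hd0 : ∀ᵐ x ∂(volume.restrict {x : ℝ | R ≤ |x|}), 0 ≤ d x)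
    (hμ : μ.restrict {x : ℝ | R ≤ |x|} = (volume.restrict {x : ℝ | R ≤ |x|}).withDensity
      fun x => ENNReal.ofReal (d x)) {f : ℝ → ℂ} (hf : Integrable f μ) :
    IntegrableOn (fun x => (d x : ℂ) * f x) {x : ℝ | R ≤ |x|} ∧
      ∫ x in {x : ℝ | R ≤ |x|}, f x ∂μ = ∫ x in {x : ℝ | R ≤ |x|}, (d x : ℂ) * f x := by
  have hm : AEMeasurable (fun x => ENNReal.ofReal (d x)) (volume.restrict {x : ℝ | R ≤ |x|}) :=
    hdm.ennreal_ofReal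
  have hlt : ∀ᵐ x ∂(volume.restrict {x : ℝ | R ≤ |x|}), ENNReal.ofReal (d x) < ⊤ :=
    Eventually.of_forall fun x => ENNReal.ofReal_lt_top
  have heq : (fun x => (ENNReal.ofReal (d x)).toReal • f x) =ᵐ[volume.restrict {x : ℝ | R ≤ |x|}]
      fun x => (d x : ℂ) * f x := by
    filter_upwards [hd0] with x hx
    rw [ENNReal.toReal_ofReal hx, Complex.real_smul]
  constructor
  · have h1 := hf.integrableOn (s := {x : ℝ | R ≤ |x|})
    rw [IntegrableOn, hμ, integrable_withDensity_iff_integrable_smul₀' hm hlt] at h1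
    exact h1.congr heq
  · rw [hμ, integral_withDensity_eq_integral_toReal_smul₀ hm hlt]
    exact integral_congr_ae heq

theorem abs_ge_eq_union (R : ℝ) : {x : ℝ | R ≤ |x|} = Iic (-R) ∪ Ici R := by
  ext x
  simp only [mem_ofPred_eq, mem_union, mem_Iic, mem_Ici, le_abs]
  constructor <;> rintro (h | h)
  · exact .inr h
  · exact .inl (by linarith)
  · exact .inr (by linarith)
  · exact .inl h

/-- The substitution `x = ±exp s` folds both tails onto one half-line in the logarithmic coordinate.
-/
theorem tendsto_integral_tail {F : ℝ → ℂ} {ℓ : ℝ}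
    (hF : IntegrableOn F {x : ℝ | Real.exp ℓ ≤ |x|})
    (hc1 : ContinuousOn F (Ici (Real.exp ℓ))) (hc2 : ContinuousOn F (Iic (-Real.exp ℓ))) :
    Tendsto (fun T : ℝ => ∫ s in ℓ..T, (F (Real.exp s) + F (-Real.exp s)) * Real.exp s) atTop
      (𝓝 (∫ x in {x : ℝ | Real.exp ℓ ≤ |x|}, F x)) := by
  set R := Real.exp ℓ
  have hR0 : 0 < R := Real.exp_pos _
  have hdisj : Disjoint (Iic (-R)) (Ici R) := by
    rw [Set.disjoint_left]; intro x hx hx'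
    simp only [mem_Iic, mem_Ici] at hx hx'; linarith
  rw [abs_ge_eq_union R] at hF ⊢
  have hF1 : IntegrableOn F (Iic (-R)) := hF.mono_set subset_union_left
  have hF2 : IntegrableOn F (Ici R) := hF.mono_set subset_union_right
  have hF1' : IntegrableOn (fun x => F (-x)) (Ioi R) := by
    have h1 := hF1.comp_neg
    rw [Set.neg_Iic, neg_neg] at h1
    exact h1.mono_set Ioi_subset_Ici_self
  have hF2' : IntegrableOn F (Ioi R) := hF2.mono_set Ioi_subset_Ici_self
  rw [setIntegral_union hdisj measurableSet_Ici hF1 hF2, integral_Ici_eq_integral_Ioi,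
    ← integral_comp_neg_Ioi, ← integral_add hF1' hF2']
  have hlim := (intervalIntegral_tendsto_integral_Ioi R (hF1'.add hF2') tendsto_id).comp
    Real.tendsto_exp_atTop
  refine hlim.congr' ?_
  filter_upwards [eventually_ge_atTop ℓ] with T hT
  have hcv := intervalIntegral.integral_deriv_smul_comp'' (a := ℓ) (b := T) (f := Real.exp)
    (f' := Real.exp) (g := fun x => F (-x) + F x) Real.continuous_exp.continuousOn
    (fun x _ => (Real.hasDerivAt_exp x).hasDerivWithinAt) Real.continuous_exp.continuousOn ?_
  · simp only [Function.comp, id, Pi.add_apply] at hcv ⊢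
    rw [← hcv]
    refine intervalIntegral.integral_congr fun s _ => ?_
    simp only [Complex.real_smul]
    ring
  · have hsub : Real.exp '' uIcc ℓ T ⊆ Ici R := by
      rintro _ ⟨s, hs, rfl⟩
      rw [uIcc_of_le hT] at hs
      exact Real.exp_le_exp.2 hs.1
    refine ContinuousOn.mono ?_ hsub
    exact (hc2.comp continuous_neg.continuousOn fun x hx => by
      simpa using hx).add hc1

/-- Deforming the contour into the lower half-plane. -/
theorem cauchyTransform_eq_of_tail {h : ℂ → ℂ} {ℓ₀ ℓ C : ℝ} (μ : Measure ℝ)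
    [IsProbabilityMeasure μ] {d : ℝ → ℝ} (hℓ : ℓ₀ < ℓ)
    (hh : DifferentiableOn ℂ h {w | ℓ₀ < w.re})
    (hb : ∀ w : ℂ, ℓ ≤ w.re → ‖h w‖ ≤ C * Real.exp (-w.re))
    (hdp : ∀ s : ℝ, ℓ ≤ s → d (Real.exp s) = (h s).im)
    (hdn : ∀ s : ℝ, ℓ ≤ s → d (-Real.exp s) = (h (s - Real.pi * Complex.I)).im)
    (hd0 : ∀ᵐ x ∂(volume.restrict {x : ℝ | Real.exp ℓ ≤ |x|}), 0 ≤ d x)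
    (hμ : μ.restrict {x : ℝ | Real.exp ℓ ≤ |x|} =
      (volume.restrict {x : ℝ | Real.exp ℓ ≤ |x|}).withDensity fun x => ENNReal.ofReal (d x))
    {w₀ : ℂ} (h1 : ℓ < w₀.re) (h2 : -Real.pi < w₀.im) (h3 : w₀.im < 0) :
    cauchyTransform μ (Complex.exp w₀) =
      (∫ x in {x : ℝ | Real.exp ℓ ≤ |x|}ᶜ, 1 / (Complex.exp w₀ - (x : ℂ)) ∂μ) +
        Real.pi * h w₀ - (arcIntegral h ℓ (Complex.exp w₀) +
          conj (arcIntegral h ℓ (conj (Complex.exp w₀)))) / 2 := by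
  set z := Complex.exp w₀ with hzdef
  have hz : z.im < 0 := im_exp_neg h2 h3
  have hms : MeasurableSet {x : ℝ | Real.exp ℓ ≤ |x|} :=
    measurableSet_le measurable_const measurable_id.abs
  have hcp : ContinuousOn d (Ici (Real.exp ℓ)) := by
    have hpos : ∀ x ∈ Ici (Real.exp ℓ), 0 < x := fun x hx => (Real.exp_pos _).trans_le hx
    have hlog : ∀ x ∈ Ici (Real.exp ℓ), ℓ ≤ Real.log x := fun x hx =>
      (Real.le_log_iff_exp_le (hpos x hx)).2 hx
    have : ContinuousOn (fun x : ℝ => (h (Real.log x : ℂ)).im) (Ici (Real.exp ℓ)) := by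
      refine Complex.continuous_im.comp_continuousOn (hh.continuousOn.comp
        (Complex.continuous_ofReal.comp_continuousOn (Real.continuousOn_log.mono fun x hx =>
          (hpos x hx).ne')) fun x hx => ?_)
      simpa using hℓ.trans_le (hlog x hx)
    refine this.congr fun x hx => ?_
    beta_reduce
    rw [← hdp _ (hlog x hx), Real.exp_log (hpos x hx)]
  have hcn : ContinuousOn d (Iic (-Real.exp ℓ)) := by
    have hpos : ∀ x ∈ Iic (-Real.exp ℓ), 0 < -x := fun x hx => by
      have := Real.exp_pos ℓ; simp only [mem_Iic] at hx; linarith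
    have hlog : ∀ x ∈ Iic (-Real.exp ℓ), ℓ ≤ Real.log (-x) := fun x hx =>
      (Real.le_log_iff_exp_le (hpos x hx)).2 (by simp only [mem_Iic] at hx; linarith)
    have : ContinuousOn (fun x : ℝ => (h ((Real.log (-x) : ℂ) - Real.pi * Complex.I)).im)
        (Iic (-Real.exp ℓ)) := by
      refine Complex.continuous_im.comp_continuousOn (hh.continuousOn.comp
        ((Complex.continuous_ofReal.comp_continuousOn (Real.continuousOn_log.comp
          continuous_neg.continuousOn fun x hx => (hpos x hx).ne')).sub continuousOn_const)
        fun x hx => ?_)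
      simpa using hℓ.trans_le (hlog x hx)
    refine this.congr fun x hx => ?_
    beta_reduce
    rw [← hdn _ (hlog x hx), Real.exp_log (hpos x hx), neg_neg]
  have hdm : AEMeasurable d (volume.restrict {x : ℝ | Real.exp ℓ ≤ |x|}) := by
    rw [abs_ge_eq_union (Real.exp ℓ), aemeasurable_union_iff]
    exact ⟨hcn.aemeasurable measurableSet_Iic, hcp.aemeasurable measurableSet_Ici⟩
  have hint := integrable_inv_sub_ofReal μ hz
  obtain ⟨hFi, hFe⟩ := integral_tail_eq hdm hd0 hμ hint
  have hFc : ∀ {s : Set ℝ}, ContinuousOn d s →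
      ContinuousOn (fun x : ℝ => (d x : ℂ) * (1 / (z - (x : ℂ)))) s := fun hs =>
    (Complex.continuous_ofReal.comp_continuousOn hs).mul
      (ContinuousOn.div (by fun_prop) (by fun_prop) fun x _ => sub_ofReal_ne_zero hz x)
  have hlim := tendsto_integral_tail hFi (hFc hcp) (hFc hcn)
  have hz' : 0 < (conj z).im := by simpa using hz
  -- The pole at `z` lies inside the contour and gives `π * h w₀` after division by `2i`; its mirror
  -- image `conj z` lies above the axis and gives no residue.
  have hlim' := ((tendsto_lineIntegral_of_im_neg hℓ hh hb h1 h2 h3).sub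
    ((Complex.continuous_conj.tendsto _).comp
      (tendsto_lineIntegral_of_im_pos hℓ hh hb hz'))).div_const (2 * Complex.I)
  have huniq := tendsto_nhds_unique hlim (hlim'.congr' ?_)
  · rw [cauchyTransform, ← integral_add_compl hms hint, hFe, huniq]
    simp only [map_neg, map_mul, Complex.conj_I]
    field_simp
    ring
  · filter_upwards [eventually_ge_atTop ℓ] with T hT
    rw [Function.comp, ← hzdef, ← integral_im_mul_kernel hℓ hh hz.ne hT]
    refine intervalIntegral.integral_congr fun s hs => ?_
    rw [uIcc_of_le hT] at hs
    simp only [hdp s hs.1, hdn s hs.1, Complex.ofReal_neg, sub_neg_eq_add, mul_one_div]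

/-! ### From the tail density to a Cauchy germ. -/

section Tail

variable {ι : Type*}

/-- The Cauchy transform of `μ`, in the coordinate `z = exp w`, is `exp (-w)` times a holomorphic
germ at `0` evaluated at the point `(exp (-a i * w))ᵢ`. -/
def HasCauchyGerm [Fintype ι] (a : ι → ℝ) (μ : Measure ℝ) : Prop :=
  ∃ g : (ι → ℂ) → ℂ, AnalyticAt ℂ g 0 ∧ g 0 = 1 ∧
    ∃ L : ℝ, ∀ w : ℂ, L < w.re → -Real.pi < w.im → w.im < 0 →
      cauchyTransform μ (Complex.exp w) = Complex.exp (-w) * g (expPoint a w)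

/-- At most `c ^ (n + 1)` exponents have integer part `n`, each contributing at most `q ^ n`; this
compares with a geometric series of ratio `q * c`. -/
theorem summable_rpow_of_isGrowthConstant {S : Set ℝ} {c q : ℝ} (hS : ∀ γ ∈ S, 0 ≤ γ)
    (h0 : (0 : ℝ) ∈ S) (hc : IsGrowthConstant S c) (hq : 0 < q) (hqc : q * c < 1) :
    Summable fun γ : S => q ^ (γ : ℝ) := by
  obtain ⟨hc0, hcn⟩ := hc
  -- Since `0 ∈ S`, the block `[0, 1)` is nonempty. Hence `q ≤ 1`, which is needed for `q ^ γ ≤ q ^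
  -- n` when `γ ≥ n`.
  have hc1 : 1 ≤ c := by
    have h := (hcn 0).2
    have h2 : 0 < (S ∩ Ico ((0 : ℕ) : ℝ) ((0 : ℕ) + 1)).ncard :=
      (ncard_pos (hcn 0).1).2 ⟨0, h0, by simp⟩
    have h3 : (1 : ℝ) ≤ ((S ∩ Ico ((0 : ℕ) : ℝ) ((0 : ℕ) + 1)).ncard : ℝ) := by exact_mod_cast h2
    simpa using h3.trans h
  have hq1 : q ≤ 1 := by nlinarith
  have hgeo : Summable fun n : ℕ => c ^ (n + 1) * q ^ n := by
    have := (summable_geometric_of_lt_one (by positivity) hqc).mul_left c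
    refine this.congr fun n => ?_
    rw [mul_pow]; ring
  refine summable_of_sum_le (c := ∑' n : ℕ, c ^ (n + 1) * q ^ n) (fun γ => by positivity) fun F => ?_
  classical
  have hmaps : ∀ γ ∈ F, ⌊(γ : ℝ)⌋₊ ∈ F.image fun γ : S => ⌊(γ : ℝ)⌋₊ := fun γ hγ =>
    Finset.mem_image_of_mem _ hγ
  rw [← Finset.sum_fiberwise_of_maps_to hmaps]
  refine (Finset.sum_le_sum fun n _ => ?_).trans
    (hgeo.sum_le_tsum _ fun n _ => by positivity)
  calc ∑ γ ∈ F.filter fun γ : S => ⌊(γ : ℝ)⌋₊ = n, q ^ (γ : ℝ)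
      ≤ ∑ γ ∈ F.filter fun γ : S => ⌊(γ : ℝ)⌋₊ = n, q ^ n := Finset.sum_le_sum fun γ hγ => by
        rw [← Real.rpow_natCast]
        refine Real.rpow_le_rpow_of_exponent_ge hq hq1 ?_
        rw [← (Finset.mem_filter.1 hγ).2]
        exact Nat.floor_le (hS _ γ.2)
    _ = (F.filter fun γ : S => ⌊(γ : ℝ)⌋₊ = n).card * q ^ n := by
        rw [Finset.sum_const, nsmul_eq_mul]
    _ ≤ c ^ (n + 1) * q ^ n := by
        gcongr
        refine le_trans ?_ (hcn n).2
        rw [← Finset.card_map (Function.Embedding.subtype _), ← ncard_coe_finset]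
        refine Nat.cast_le.2 (ncard_le_ncard ?_ (hcn n).1)
        intro γ hγ
        simp only [Finset.coe_map, Function.Embedding.subtype_apply, mem_image, Finset.mem_coe,
          Finset.mem_filter] at hγ
        obtain ⟨γ', ⟨-, hfl⟩, rfl⟩ := hγ
        refine ⟨γ'.2, ?_⟩
        rw [← hfl]
        exact ⟨Nat.floor_le (hS _ γ'.2), Nat.lt_floor_add_one _⟩

theorem norm_mul_exp_le {γ r x : ℝ} {b w : ℂ} (hb : ‖b‖ ≤ r ^ γ) (hr : 0 < r) (hγ : 0 ≤ γ)
    (hw : x ≤ w.re) :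
    ‖b * Complex.exp (-(γ : ℂ) * w)‖ ≤ (r * Real.exp (-x)) ^ γ := by
  rw [norm_mul, Complex.norm_exp, Real.mul_rpow hr.le (Real.exp_pos _).le, ← Real.exp_mul]
  gcongr
  simp only [Complex.mul_re, Complex.neg_re, Complex.ofReal_re, Complex.neg_im, Complex.ofReal_im,
    neg_zero, zero_mul, sub_zero]
  nlinarith

theorem cpow_ofReal_of_exp_eq {x : ℝ} {w : ℂ} (hx : (x : ℂ) = Complex.exp w) (h1 : -Real.pi < w.im)
    (h2 : w.im ≤ Real.pi) (s : ℂ) : (x : ℂ) ^ s = Complex.exp (s * w) := by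
  rw [hx, Complex.cpow_def_of_ne_zero (Complex.exp_ne_zero _), Complex.log_exp h1 h2, mul_comm]

/-- The tail density in the coordinate `x = exp w`, where `w` is real or lies on `Im w = -π`. -/
theorem tailDensity_eq_im {S : Set ℝ} {a b : ℝ → ℂ} (hb : ∀ γ ∈ S, 0 < γ → b γ = a γ)
    (hb0 : ∀ γ, ¬ 0 < γ → b γ = 0) {x : ℝ} {w : ℂ} (hx : (x : ℂ) = Complex.exp w)
    (h1 : -Real.pi ≤ w.im) (h2 : w.im < Real.pi)
    (hs : Summable fun γ : S => b γ * Complex.exp (-((γ : ℝ) : ℂ) * w)) :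
    tailDensity S a x =
      (Complex.exp (-w) * ∑' γ : S, b γ * Complex.exp (-((γ : ℝ) : ℂ) * w)).im := by
  have hxi : ((1 / x : ℝ) : ℂ) = Complex.exp (-w) := by
    push_cast; rw [hx, Complex.exp_neg, one_div]
  rw [← tsum_mul_left, Complex.im_tsum (hs.mul_left _), tailDensity]
  have e1 := tsum_subtype {β : ℝ | β ∈ S ∧ 0 < β}
    fun β => (a β * (((1 / x : ℝ) : ℂ) ^ ((β + 1 : ℝ) : ℂ))).im
  have e2 := tsum_subtype S
    fun β => (Complex.exp (-w) * (b β * Complex.exp (-(β : ℂ) * w))).im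
  refine e1.trans (Eq.trans (tsum_congr fun β => ?_) e2.symm)
  by_cases hβS : β ∈ S
  · by_cases hβ : 0 < β
    -- For negative `x` one has `Im w = -π`, so `-w` lies on the edge `Im = π`, which belongs to the
    -- principal branch.
    · rw [indicator_of_mem (show β ∈ {β : ℝ | β ∈ S ∧ 0 < β} from ⟨hβS, hβ⟩), indicator_of_mem hβS,
        hb β hβS hβ, cpow_ofReal_of_exp_eq hxi (by simpa using h2) (by simp; linarith), mul_left_comm, ← Complex.exp_add]
      congr 3
      push_cast; ring
    · rw [indicator_of_notMem (fun h => hβ h.2), indicator_of_mem hβS, hb0 β hβ]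
      simp
  · rw [indicator_of_notMem (fun h => hβS h.1), indicator_of_notMem hβS]

theorem tendsto_exp_mul_cauchyTransform (μ : Measure ℝ) [IsProbabilityMeasure μ] :
    Tendsto (fun x : ℝ => Complex.exp (x - Real.pi / 2 * Complex.I) *
      cauchyTransform μ (Complex.exp (x - Real.pi / 2 * Complex.I))) atTop (𝓝 1) := by
  refine (tendsto_mul_cauchyTransform μ one_pos).comp (tendsto_inf.2 ⟨?_, ?_⟩)
  · rw [tendsto_comap_iff]
    refine Real.tendsto_exp_atTop.congr fun x => ?_
    simp [Function.comp, Complex.norm_exp]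
  · refine tendsto_principal.2 (Eventually.of_forall fun x => ?_)
    have : Complex.exp (x - Real.pi / 2 * Complex.I) = ⟨0, -Real.exp x⟩ := by
      rw [Complex.exp_eq_exp_re_mul_sin_add_cos]
      apply Complex.ext <;> simp [Complex.exp_ofReal_re]
    rw [mem_ofPred_eq, this]
    simp [Real.exp_pos]

/-- The germ of a Cauchy transform takes the value `1` at the origin. -/
theorem germ_zero_eq_one {a : ι → ℝ} (ha : ∀ i, 0 < a i) (μ : Measure ℝ) [IsProbabilityMeasure μ]
    {g : (ι → ℂ) → ℂ} (hg : ContinuousAt g 0) {L : ℝ}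
    (h : ∀ w : ℂ, L < w.re → -Real.pi < w.im → w.im < 0 →
      cauchyTransform μ (Complex.exp w) = Complex.exp (-w) * g (expPoint a w)) : g 0 = 1 := by
  have h1 : Tendsto (fun x : ℝ => g (expPoint a (x - Real.pi / 2 * Complex.I))) atTop (𝓝 (g 0)) := by
    refine hg.tendsto.comp ((tendsto_expPoint ha).comp (tendsto_comap_iff.2 ?_))
    refine tendsto_id.congr fun x => ?_
    simp
  refine tendsto_nhds_unique h1 ((tendsto_exp_mul_cauchyTransform μ).congr' ?_)
  filter_upwards [eventually_gt_atTop L] with x hx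
  rw [h _ (by simpa using hx) (by simp; linarith [Real.pi_pos]) (by simp; linarith [Real.pi_pos]),
    ← mul_assoc, ← Complex.exp_add, add_neg_cancel, Complex.exp_zero, one_mul]

theorem arcIntegral_eq (h : ℂ → ℂ) (ℓ : ℝ) {z : ℂ} (hz : z ≠ 0) :
    arcIntegral h ℓ z = z⁻¹ * ∫ y in Ioc (-Real.pi) 0,
      h (ℓ + y * Complex.I) * Complex.exp (ℓ + y * Complex.I) /
        (1 - z⁻¹ * Complex.exp (ℓ + y * Complex.I)) := by
  rw [arcIntegral, intervalIntegral.integral_of_le (by linarith [Real.pi_pos]),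
    ← integral_const_mul]
  refine integral_congr_ae (Eventually.of_forall fun y => ?_)
  have : z - Complex.exp (ℓ + y * Complex.I) =
    z * (1 - z⁻¹ * Complex.exp (ℓ + y * Complex.I)) := by field_simp
  simp only [expKernel]
  rw [this, div_mul_eq_div_div, div_eq_inv_mul _ z, ← mul_div_assoc]

theorem hasCauchyGerm_of_memP [Fintype ι] {a : ι → ℝ} (ha : ∀ i, 0 < a i) {o : ι} (ho : a o = 1) {c : ℝ}
    (hc : IsGrowthConstant (natSpan a) c) (μ : Measure ℝ) [IsProbabilityMeasure μ]
    (hμ : MemP (natSpan a) c μ) : HasCauchyGerm a μ := by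
  classical
  obtain ⟨k, r, R, hr, hR, hk, hrR, hpos, hres⟩ := hμ
  have hc0 := hc.1
  have hrR' : c * r < R := by
    have := mul_lt_mul_of_pos_left hrR hc0
    rwa [← mul_assoc, mul_inv_cancel₀ hc0.ne', one_mul] at this
  -- A radius strictly between `c * r` and `R`: the series converges uniformly from `log R₀` on, so
  -- `h` is holomorphic across the arc at `log R`.
  set R₀ : ℝ := (c * r + R) / 2 with hR₀
  have hR₀pos : 0 < R₀ := by positivity
  set ℓ₀ := Real.log R₀ with hℓ₀
  set ℓ := Real.log R with hℓ
  have hℓℓ : ℓ₀ < ℓ := Real.log_lt_log hR₀pos (by linarith)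
  have hexpℓ : Real.exp ℓ = R := Real.exp_log hR
  -- The density has no term at exponent `0`, whereas the sum over the semigroup does; zero is
  -- inserted there.
  let b : ℝ → ℂ := fun γ => if 0 < γ ∧ γ ∈ natSpan a then k γ else 0
  have hbk : ∀ γ ∈ natSpan a, ‖b γ‖ ≤ r ^ γ := fun γ hγ => by
    by_cases h : 0 < γ
    · simp only [b, if_pos (show 0 < γ ∧ γ ∈ natSpan a from ⟨h, hγ⟩)]; exact hk γ hγ h
    · simp only [b, if_neg (fun h' : 0 < γ ∧ γ ∈ natSpan a => h h'.1), norm_zero]; positivity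
  set q := r * Real.exp (-ℓ₀) with hq
  have hqsum : Summable fun γ : natSpan a => q ^ (γ : ℝ) := by
    refine summable_rpow_of_isGrowthConstant (fun γ => natSpan_nonneg ha) (zero_mem_natSpan a) hc
      (by positivity) ?_
    rw [hq, Real.exp_neg, hℓ₀, Real.exp_log hR₀pos, mul_right_comm, ← div_eq_mul_inv,
      div_lt_one hR₀pos]
    rw [hR₀]; linarith
  have hterm : ∀ (γ : natSpan a) (w : ℂ), ℓ₀ ≤ w.re →
      ‖b γ * Complex.exp (-((γ : ℝ) : ℂ) * w)‖ ≤ q ^ (γ : ℝ) := fun γ w hw =>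
    norm_mul_exp_le (hbk γ γ.2) hr (natSpan_nonneg ha γ.2) hw
  have hsum : ∀ w : ℂ, ℓ₀ ≤ w.re →
      Summable fun γ : natSpan a => b γ * Complex.exp (-((γ : ℝ) : ℂ) * w) := fun w hw =>
    Summable.of_norm_bounded hqsum fun γ => hterm γ w hw
  let D : ℂ → ℂ := fun w => ∑' γ : natSpan a, b γ * Complex.exp (-((γ : ℝ) : ℂ) * w)
  let h : ℂ → ℂ := fun w => Complex.exp (-w) * D w
  have hopen : IsOpen {w : ℂ | ℓ₀ < w.re} := isOpen_lt continuous_const Complex.continuous_re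
  have hD : DifferentiableOn ℂ D {w | ℓ₀ < w.re} :=
    Complex.differentiableOn_tsum_of_summable_norm hqsum
      (fun γ => by fun_prop) hopen fun γ w hw => hterm γ w (le_of_lt hw)
  have hh : DifferentiableOn ℂ h {w | ℓ₀ < w.re} :=
    DifferentiableOn.mul (by fun_prop) hD
  set C := ∑' γ : natSpan a, q ^ (γ : ℝ) with hC
  have hDb : ∀ w : ℂ, ℓ₀ ≤ w.re → ‖D w‖ ≤ C := fun w hw =>
    tsum_of_norm_bounded hqsum.hasSum fun γ => hterm γ w hw
  have hC0 : 0 ≤ C := tsum_nonneg fun γ => by positivity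
  have hb : ∀ w : ℂ, ℓ ≤ w.re → ‖h w‖ ≤ C * Real.exp (-w.re) := fun w hw => by
    simp only [h]
    rw [norm_mul, Complex.norm_exp, mul_comm, Complex.neg_re]
    gcongr
    exact hDb w (hℓℓ.le.trans hw)
  have hb1 : ∀ γ ∈ natSpan a, 0 < γ → b γ = k γ := fun γ hγ h => if_pos ⟨h, hγ⟩
  have hb0 : ∀ γ, ¬ 0 < γ → b γ = 0 := fun γ h => if_neg fun h' => h h'.1
  have hdp : ∀ s : ℝ, ℓ ≤ s → tailDensity (natSpan a) k (Real.exp s) = (h s).im := fun s hs =>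
    tailDensity_eq_im hb1 hb0 (Complex.ofReal_exp s) (by simp [Real.pi_pos.le])
      (by simp [Real.pi_pos]) (hsum _ (by simpa using (hℓℓ.trans_le hs).le))
  have hdn : ∀ s : ℝ, ℓ ≤ s → tailDensity (natSpan a) k (-Real.exp s) =
      (h (s - Real.pi * Complex.I)).im := fun s hs =>
    tailDensity_eq_im hb1 hb0 (by rw [exp_sub_pi_mul_I]; push_cast; rfl) (by simp)
      (by simp; linarith [Real.pi_pos]) (hsum _ (by simpa using (hℓℓ.trans_le hs).le))
  rw [← hexpℓ] at hpos hres
  have hmain := fun (w₀ : ℂ) => cauchyTransform_eq_of_tail μ (w₀ := w₀) hℓℓ hh hb hdp hdn hpos hres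
  obtain ⟨H, hH, -, hHs⟩ := exists_analyticAt_of_coeff ha (C := 1) hr
    (fun γ hγ => by rw [one_mul]; exact hbk γ hγ)
  have hu : Continuous fun y : ℝ => Complex.exp (ℓ + y * Complex.I) := by fun_prop
  have hv : Continuous fun y : ℝ =>
      h (ℓ + y * Complex.I) * Complex.exp (ℓ + y * Complex.I) := by
    refine Continuous.mul ?_ hu
    exact hh.continuousOn.comp_continuous (by fun_prop) fun y => by simpa using hℓℓ
  have hun : ∀ y : ℝ, ‖Complex.exp (ℓ + y * Complex.I)‖ ≤ R := fun y => by
    rw [Complex.norm_exp]; simp [hexpℓ]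
  have hvn : ∀ y : ℝ, ‖h (ℓ + y * Complex.I) * Complex.exp (ℓ + y * Complex.I)‖ ≤ C := fun y => by
    rw [norm_mul]
    have h1 := hb (ℓ + y * Complex.I) (by simp)
    rw [Complex.norm_exp]
    calc _ ≤ C * Real.exp (-((ℓ : ℂ) + y * Complex.I).re) * Real.exp ((ℓ : ℂ) + y * Complex.I).re := by
          gcongr
      _ = C := by rw [mul_assoc, ← Real.exp_add]; simp
  have hK1 : AnalyticAt ℂ (fun t : ℂ => ∫ x in {x : ℝ | Real.exp ℓ ≤ |x|}ᶜ,
      (1 : ℂ) / (1 - t * (x : ℂ)) ∂μ) 0 := by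
    refine analyticAt_integral_div_one_sub (R := R) (C := 1) _
      Complex.measurable_ofReal.aestronglyMeasurable aestronglyMeasurable_const ?_
      (by simp) hR.le zero_le_one
    have hms : MeasurableSet {x : ℝ | Real.exp ℓ ≤ |x|} :=
      measurableSet_le measurable_const measurable_id.abs
    rw [ae_restrict_iff' hms.compl]
    refine Eventually.of_forall fun x hx => ?_
    rw [hexpℓ, mem_compl_iff, mem_ofPred_eq, not_le] at hx
    rw [Complex.norm_real]
    exact hx.le
  have hK2 : AnalyticAt ℂ (fun t : ℂ => ∫ y in Ioc (-Real.pi) 0,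
      h (ℓ + y * Complex.I) * Complex.exp (ℓ + y * Complex.I) /
        (1 - t * Complex.exp (ℓ + y * Complex.I))) 0 :=
    analyticAt_integral_div_one_sub (R := R) (C := C) _ hu.aestronglyMeasurable
      hv.aestronglyMeasurable (Eventually.of_forall hun) (Eventually.of_forall hvn) hR.le hC0
  have hK3 : AnalyticAt ℂ (fun t : ℂ => ∫ y in Ioc (-Real.pi) 0,
      conj (h (ℓ + y * Complex.I) * Complex.exp (ℓ + y * Complex.I)) /
        (1 - t * conj (Complex.exp (ℓ + y * Complex.I)))) 0 :=
    analyticAt_integral_div_one_sub (R := R) (C := C) _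
      (Complex.continuous_conj.comp hu).aestronglyMeasurable
      (Complex.continuous_conj.comp hv).aestronglyMeasurable
      (Eventually.of_forall fun y => (RCLike.norm_conj _).trans_le (hun y))
      (Eventually.of_forall fun y => (RCLike.norm_conj _).trans_le (hvn y)) hR.le hC0
  -- Everything in the contour formula except the residue, as a function of `t = 1 / z`.
  let K : ℂ → ℂ := fun t => (∫ x in {x : ℝ | Real.exp ℓ ≤ |x|}ᶜ, (1 : ℂ) / (1 - t * (x : ℂ)) ∂μ) -
    ((∫ y in Ioc (-Real.pi) 0, h (ℓ + y * Complex.I) * Complex.exp (ℓ + y * Complex.I) /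
        (1 - t * Complex.exp (ℓ + y * Complex.I))) +
      ∫ y in Ioc (-Real.pi) 0, conj (h (ℓ + y * Complex.I) * Complex.exp (ℓ + y * Complex.I)) /
        (1 - t * conj (Complex.exp (ℓ + y * Complex.I)))) * (1 / 2)
  have hK : AnalyticAt ℂ K 0 := hK1.sub ((hK2.add hK3).mul analyticAt_const)
  have hKz : ∀ z : ℂ, z ≠ 0 → z⁻¹ * K z⁻¹ =
      (∫ x in {x : ℝ | Real.exp ℓ ≤ |x|}ᶜ, 1 / (z - (x : ℂ)) ∂μ) -
        (arcIntegral h ℓ z + conj (arcIntegral h ℓ (conj z))) / 2 := by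
    intro z hz
    have hz' : conj z ≠ 0 := by simpa using hz
    rw [arcIntegral_eq h ℓ hz, arcIntegral_eq h ℓ hz', map_mul, ← integral_conj]
    simp only [map_div₀, map_sub, map_mul, map_one, map_inv₀, Complex.conj_conj]
    have e1 : ∫ x in {x : ℝ | Real.exp ℓ ≤ |x|}ᶜ, 1 / (z - (x : ℂ)) ∂μ =
        z⁻¹ * ∫ x in {x : ℝ | Real.exp ℓ ≤ |x|}ᶜ, (1 : ℂ) / (1 - z⁻¹ * (x : ℂ)) ∂μ := by
      rw [← integral_const_mul]
      refine integral_congr_ae (Eventually.of_forall fun x => ?_)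
      have : z - (x : ℂ) = z * (1 - z⁻¹ * x) := by field_simp
      beta_reduce
      rw [this, div_mul_eq_div_div, div_eq_inv_mul 1 z, ← mul_div_assoc]
    rw [e1]
    simp only [K, map_mul]
    ring
  -- Since `a o = 1`, the coordinate `s o` is `1 / z` at `expPoint a w`. This is why the integer
  -- generator must belong to the semigroup.
  let g : (ι → ℂ) → ℂ := fun s => K (s o) + Real.pi * H s
  have hg : AnalyticAt ℂ g 0 := by
    refine AnalyticAt.add ?_ (analyticAt_const.mul hH)
    exact AnalyticAt.fun_comp (g := K) (f := fun s : ι → ℂ => s o) hK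
      ((ContinuousLinearMap.proj (R := ℂ) (φ := fun _ : ι => ℂ) o).analyticAt _)
  obtain ⟨L, hL⟩ := eventually_re_iff.1 hHs
  have hfinal : ∀ w : ℂ, max L ℓ < w.re → -Real.pi < w.im → w.im < 0 →
      cauchyTransform μ (Complex.exp w) = Complex.exp (-w) * g (expPoint a w) := by
    intro w hw h1 h2
    rw [hmain w ((le_max_right _ _).trans_lt hw) h1 h2]
    have e1 := hKz (Complex.exp w) (Complex.exp_ne_zero _)
    have e2 : H (expPoint a w) = D w := (hL w ((le_max_left _ _).trans_lt hw)).tsum_eq.symm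
    have e3 : expPoint a w o = (Complex.exp w)⁻¹ := by
      simp only [expPoint, ho, Complex.ofReal_one, ← Complex.exp_neg]; ring_nf
    have e4 : h w = (Complex.exp w)⁻¹ * D w := by simp only [h, Complex.exp_neg]
    simp only [g, e2, e3, e4, Complex.exp_neg]
    linear_combination -e1
  exact ⟨g, hg, germ_zero_eq_one ha μ hg.continuousAt hfinal, max L ℓ, hfinal⟩

end Tail

/-! ### Stieltjes inversion with continuous boundary values. -/

section Stieltjes

theorem integral_poisson_kernel {y : ℝ} (hy : 0 < y) (t a b : ℝ) :
    ∫ x in a..b, y / ((x - t) ^ 2 + y ^ 2) =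
      Real.arctan ((b - t) / y) - Real.arctan ((a - t) / y) := by
  have hne : ∀ x : ℝ, (x - t) ^ 2 + y ^ 2 ≠ 0 := fun x => by positivity
  refine intervalIntegral.integral_eq_sub_of_hasDerivAt
    (f := fun x => Real.arctan ((x - t) / y)) (fun x _ => ?_)
    (Continuous.intervalIntegrable
      (continuous_const.div (by fun_prop) hne) _ _)
  refine (((hasDerivAt_id x).sub_const t).div_const y).arctan.congr_deriv ?_
  have := hne x
  simp only [id]
  field_simp
  ring

theorem im_cauchyTransform_sub_mul_I (μ : Measure ℝ) [IsFiniteMeasure μ] (x : ℝ) {y : ℝ}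
    (hy : 0 < y) :
    (cauchyTransform μ (x - y * Complex.I)).im = ∫ t, y / ((x - t) ^ 2 + y ^ 2) ∂μ := by
  rw [im_cauchyTransform μ (by simpa using hy)]
  refine integral_congr_ae (Eventually.of_forall fun t => ?_)
  beta_reduce
  rw [← Complex.normSq_eq_norm_sq, Complex.normSq_apply]
  simp
  ring

theorem integral_im_cauchyTransform (μ : Measure ℝ) [IsFiniteMeasure μ] {y : ℝ} (hy : 0 < y)
    {a b : ℝ} (hab : a ≤ b) :
    ∫ x in a..b, (cauchyTransform μ (x - y * Complex.I)).im =
      ∫ t, (Real.arctan ((b - t) / y) - Real.arctan ((a - t) / y)) ∂μ := by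
  simp only [im_cauchyTransform_sub_mul_I μ _ hy, ← integral_poisson_kernel hy]
  simp only [intervalIntegral.integral_of_le hab]
  refine integral_integral_swap ?_
  have hne : ∀ p : ℝ × ℝ, (p.1 - p.2) ^ 2 + y ^ 2 ≠ 0 := fun p => by positivity
  refine Integrable.of_bound (C := y / y ^ 2)
    (Continuous.aestronglyMeasurable (continuous_const.div (by fun_prop) hne))
    (Eventually.of_forall fun p => ?_)
  simp only [Function.uncurry]
  rw [Real.norm_of_nonneg (by positivity)]
  gcongr
  nlinarith [sq_nonneg (p.1 - p.2)]

/-- The limit of `arctan (s / y)` as `y` decreases to `0`. -/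
theorem tendsto_arctan_div (s : ℝ) :
    Tendsto (fun y : ℝ => Real.arctan (s / y)) (𝓝[>] 0) (𝓝 (Real.pi / 2 * Real.sign s)) := by
  rcases lt_trichotomy s 0 with hs | rfl | hs
  · rw [Real.sign_of_neg hs, mul_neg_one]
    have h : Tendsto (fun y : ℝ => s / y) (𝓝[>] 0) atBot := by
      simp only [div_eq_mul_inv]
      exact tendsto_inv_nhdsGT_zero.const_mul_atTop_of_neg hs
    exact (Real.tendsto_arctan_atBot.mono_right nhdsWithin_le_nhds).comp h
  · simp
  · rw [Real.sign_of_pos hs, mul_one]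
    have h : Tendsto (fun y : ℝ => s / y) (𝓝[>] 0) atTop := by
      simp only [div_eq_mul_inv]
      exact tendsto_inv_nhdsGT_zero.const_mul_atTop hs
    exact (Real.tendsto_arctan_atTop.mono_right nhdsWithin_le_nhds).comp h

variable {μ : Measure ℝ} {κ : ℂ → ℂ} {ρ : ℝ}

theorem continuous_ofReal_sub_mul_I : Continuous fun p : ℝ × ℝ => (p.1 : ℂ) - p.2 * Complex.I := by
  fun_prop

theorem mem_boundary_region {x y : ℝ} (hx : ρ < |x|) (hy : 0 ≤ y) :
    (x : ℂ) - y * Complex.I ∈ {z : ℂ | z.im ≤ 0 ∧ ρ < ‖z‖} := by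
  refine ⟨by simpa using hy, hx.trans_le ?_⟩
  have := Complex.abs_re_le_norm ((x : ℂ) - y * Complex.I)
  simpa using this

theorem tendsto_boundary (hκ : ContinuousOn κ {z : ℂ | z.im ≤ 0 ∧ ρ < ‖z‖}) {x : ℝ}
    (hx : ρ < |x|) :
    Tendsto (fun y : ℝ => (κ (x - y * Complex.I)).im) (𝓝[>] 0) (𝓝 (κ x).im) := by
  have h0 : (x : ℂ) ∈ {z : ℂ | z.im ≤ 0 ∧ ρ < ‖z‖} := by
    simpa using mem_boundary_region hx le_rfl
  refine (Complex.continuous_im.tendsto _).comp ((hκ _ h0).tendsto.comp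
    (tendsto_nhdsWithin_iff.2 ⟨?_, ?_⟩))
  · have : Continuous fun y : ℝ => (x : ℂ) - y * Complex.I := by fun_prop
    have h1 := this.tendsto 0
    simp only [Complex.ofReal_zero, zero_mul, sub_zero] at h1
    exact h1.mono_left nhdsWithin_le_nhds
  · filter_upwards [self_mem_nhdsWithin] with y hy
    exact mem_boundary_region hx (le_of_lt hy)

theorem im_boundary_nonneg [IsProbabilityMeasure μ]
    (hκ : ContinuousOn κ {z : ℂ | z.im ≤ 0 ∧ ρ < ‖z‖})
    (hG : ∀ z : ℂ, z.im < 0 → ρ < ‖z‖ → cauchyTransform μ z = κ z) {x : ℝ} (hx : ρ < |x|) :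
    0 ≤ (κ x).im := by
  refine ge_of_tendsto (tendsto_boundary hκ hx) ?_
  filter_upwards [self_mem_nhdsWithin] with y hy
  have hy' : ((x : ℂ) - y * Complex.I).im < 0 := by simpa using hy
  rw [← hG _ hy' (mem_boundary_region hx (le_of_lt hy)).2]
  exact (im_cauchyTransform_pos μ hy').le

theorem continuousOn_boundary (hκ : ContinuousOn κ {z : ℂ | z.im ≤ 0 ∧ ρ < ‖z‖}) {s : Set ℝ}
    (hs : ∀ x ∈ s, ρ < |x|) {y : ℝ} (hy : 0 ≤ y) :
    ContinuousOn (fun x : ℝ => (κ (x - y * Complex.I)).im) s :=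
  Complex.continuous_im.comp_continuousOn
    (hκ.comp (by fun_prop) fun x hx => mem_boundary_region (hs x hx) hy)

theorem continuousOn_boundary_zero (hκ : ContinuousOn κ {z : ℂ | z.im ≤ 0 ∧ ρ < ‖z‖}) {s : Set ℝ}
    (hs : ∀ x ∈ s, ρ < |x|) : ContinuousOn (fun x : ℝ => (κ x).im) s := by
  simpa using continuousOn_boundary hκ hs le_rfl

theorem tendsto_integral_boundary (hκ : ContinuousOn κ {z : ℂ | z.im ≤ 0 ∧ ρ < ‖z‖}) {a b : ℝ}
    (hab : a ≤ b) (hs : ∀ x ∈ Icc a b, ρ < |x|) :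
    Tendsto (fun y : ℝ => ∫ x in a..b, (κ (x - y * Complex.I)).im) (𝓝[>] 0)
      (𝓝 (∫ x in a..b, (κ x).im)) := by
  have hcomp : IsCompact (Icc a b ×ˢ Icc (0 : ℝ) 1) := isCompact_Icc.prod isCompact_Icc
  have hcont : ContinuousOn (fun p : ℝ × ℝ => (κ (p.1 - p.2 * Complex.I)).im)
      (Icc a b ×ˢ Icc (0 : ℝ) 1) :=
    Complex.continuous_im.comp_continuousOn
      (hκ.comp continuous_ofReal_sub_mul_I.continuousOn fun p hp =>
        mem_boundary_region (hs _ hp.1) hp.2.1)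
  obtain ⟨M, hM⟩ := hcomp.exists_bound_of_continuousOn hcont
  have hev : ∀ᶠ y : ℝ in 𝓝[>] 0, 0 < y ∧ y ≤ 1 := Ioc_mem_nhdsGT one_pos
  refine intervalIntegral.tendsto_integral_filter_of_dominated_convergence (fun _ => M) ?_ ?_
    intervalIntegrable_const ?_
  · filter_upwards [hev] with y hy
    rw [uIoc_of_le hab]
    exact ((continuousOn_boundary hκ hs hy.1.le).mono Ioc_subset_Icc_self).aestronglyMeasurable
      measurableSet_Ioc
  · filter_upwards [hev] with y hy
    refine Eventually.of_forall fun x hx => ?_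
    rw [uIoc_of_le hab] at hx
    exact hM (x, y) ⟨Ioc_subset_Icc_self hx, hy.1.le, hy.2⟩
  · refine Eventually.of_forall fun x hx => ?_
    rw [uIoc_of_le hab] at hx
    exact tendsto_boundary hκ (hs x (Ioc_subset_Icc_self hx))

/-- Let the height tend to `0` in the Fubini identity `integral_im_cauchyTransform`: continuity of
`κ` handles one side, and the bounded pointwise limit of the arctangents the other. -/
theorem integral_boundary_eq [IsProbabilityMeasure μ]
    (hκ : ContinuousOn κ {z : ℂ | z.im ≤ 0 ∧ ρ < ‖z‖})
    (hG : ∀ z : ℂ, z.im < 0 → ρ < ‖z‖ → cauchyTransform μ z = κ z) {a b : ℝ} (hab : a ≤ b)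
    (hs : ∀ x ∈ Icc a b, ρ < |x|) :
    ∫ x in a..b, (κ x).im =
      ∫ t, (Real.pi / 2 * Real.sign (b - t) - Real.pi / 2 * Real.sign (a - t)) ∂μ := by
  refine tendsto_nhds_unique (tendsto_integral_boundary hκ hab hs) ?_
  have h1 : Tendsto (fun y : ℝ => ∫ t, (Real.arctan ((b - t) / y) - Real.arctan ((a - t) / y)) ∂μ)
      (𝓝[>] 0)
      (𝓝 (∫ t, (Real.pi / 2 * Real.sign (b - t) - Real.pi / 2 * Real.sign (a - t)) ∂μ)) := by
    refine tendsto_integral_filter_of_dominated_convergence (fun _ => Real.pi) ?_ ?_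
      (integrable_const _) (Eventually.of_forall fun t =>
        (tendsto_arctan_div (b - t)).sub (tendsto_arctan_div (a - t)))
    · refine Eventually.of_forall fun y => Measurable.aestronglyMeasurable ?_
      exact (Real.measurable_arctan.comp ((measurable_const.sub measurable_id).div_const y)).sub
        (Real.measurable_arctan.comp ((measurable_const.sub measurable_id).div_const y))
    · refine Eventually.of_forall fun y => Eventually.of_forall fun t => ?_
      rw [Real.norm_eq_abs, abs_le]
      have h1 := Real.arctan_lt_pi_div_two ((b - t) / y)
      have h2 := Real.neg_pi_div_two_lt_arctan ((b - t) / y)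
      have h3 := Real.arctan_lt_pi_div_two ((a - t) / y)
      have h4 := Real.neg_pi_div_two_lt_arctan ((a - t) / y)
      constructor <;> linarith
  refine h1.congr' ?_
  filter_upwards [self_mem_nhdsWithin] with y hy
  rw [← integral_im_cauchyTransform μ hy hab]
  refine intervalIntegral.integral_congr fun x hx => ?_
  rw [uIcc_of_le hab] at hx
  rw [hG _ (by simpa using hy) (mem_boundary_region (hs x hx) (le_of_lt hy)).2]

/-- The limit kernel is `π` inside the interval, `0` outside and `π / 2` at the endpoints. -/
theorem sign_diff_bounds {a b : ℝ} (hab : a < b) (t : ℝ) :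
    (Ioo a b).indicator (fun _ => Real.pi) t ≤
        Real.pi / 2 * Real.sign (b - t) - Real.pi / 2 * Real.sign (a - t) ∧
      Real.pi / 2 * Real.sign (b - t) - Real.pi / 2 * Real.sign (a - t) ≤
        (Icc a b).indicator (fun _ => Real.pi) t := by
  have hpi := Real.pi_pos
  rcases lt_trichotomy t a with h | rfl | h
  · rw [Real.sign_of_pos (sub_pos.2 h), Real.sign_of_pos (sub_pos.2 (h.trans hab)),
      indicator_of_notMem (fun h' => absurd h'.1 (not_lt.2 h.le)),
      indicator_of_notMem (fun h' => absurd h'.1 (not_le.2 h))]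
    simp
  · rw [sub_self, Real.sign_zero, Real.sign_of_pos (sub_pos.2 hab),
      indicator_of_notMem (fun h' => absurd h'.1 (lt_irrefl _)),
      indicator_of_mem (left_mem_Icc.2 hab.le)]
    constructor <;> linarith
  · rw [Real.sign_of_neg (sub_neg.2 h)]
    rcases lt_trichotomy t b with h' | rfl | h'
    · rw [Real.sign_of_pos (sub_pos.2 h'), indicator_of_mem (show t ∈ Ioo a b from ⟨h, h'⟩),
        indicator_of_mem (show t ∈ Icc a b from ⟨h.le, h'.le⟩)]
      constructor <;> linarith
    · rw [sub_self, Real.sign_zero, indicator_of_notMem (fun h' => absurd h'.2 (lt_irrefl _)),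
        indicator_of_mem (right_mem_Icc.2 hab.le)]
      constructor <;> linarith
    · rw [Real.sign_of_neg (sub_neg.2 h'),
        indicator_of_notMem (fun h'' => absurd h''.2 (not_lt.2 h'.le)),
        indicator_of_notMem (fun h'' => absurd h''.2 (not_le.2 h'))]
      simp

theorem measurable_sign_diff (a b : ℝ) : Measurable fun t : ℝ =>
    Real.pi / 2 * Real.sign (b - t) - Real.pi / 2 * Real.sign (a - t) := by
  have hs : Measurable Real.sign := by
    unfold Real.sign
    exact Measurable.ite measurableSet_Iio measurable_const
      (Measurable.ite measurableSet_Ioi measurable_const measurable_const)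
  exact ((hs.comp (measurable_const.sub measurable_id)).const_mul _).sub
    ((hs.comp (measurable_const.sub measurable_id)).const_mul _)

theorem measureReal_bounds [IsProbabilityMeasure μ]
    (hκ : ContinuousOn κ {z : ℂ | z.im ≤ 0 ∧ ρ < ‖z‖})
    (hG : ∀ z : ℂ, z.im < 0 → ρ < ‖z‖ → cauchyTransform μ z = κ z) {a b : ℝ} (hab : a < b)
    (hs : ∀ x ∈ Icc a b, ρ < |x|) :
    Real.pi * μ.real (Ioo a b) ≤ ∫ x in a..b, (κ x).im ∧
      ∫ x in a..b, (κ x).im ≤ Real.pi * μ.real (Icc a b) := by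
  rw [integral_boundary_eq hκ hG hab.le hs]
  have hint : Integrable (fun t : ℝ =>
      Real.pi / 2 * Real.sign (b - t) - Real.pi / 2 * Real.sign (a - t)) μ := by
    refine Integrable.of_bound (C := Real.pi) (measurable_sign_diff a b).aestronglyMeasurable
      (Eventually.of_forall fun t => ?_)
    obtain ⟨h1, h2⟩ := sign_diff_bounds hab t
    have h3 : 0 ≤ (Ioo a b).indicator (fun _ => Real.pi) t :=
      indicator_nonneg (fun _ _ => Real.pi_pos.le) _
    have h4 : (Icc a b).indicator (fun _ => Real.pi) t ≤ Real.pi :=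
      indicator_apply_le' (fun _ => le_rfl) fun _ => Real.pi_pos.le
    rw [Real.norm_of_nonneg (h3.trans h1)]
    exact h2.trans h4
  have hI : ∀ {s : Set ℝ}, MeasurableSet s →
      ∫ t, s.indicator (fun _ => Real.pi) t ∂μ = Real.pi * μ.real s := fun hs => by
    rw [integral_indicator hs, setIntegral_const, smul_eq_mul, mul_comm]
  rw [← hI measurableSet_Ioo, ← hI measurableSet_Icc]
  exact ⟨integral_mono ((integrable_const _).indicator measurableSet_Ioo) hint
      fun t => (sign_diff_bounds hab t).1,
    integral_mono hint ((integrable_const _).indicator measurableSet_Icc)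
      fun t => (sign_diff_bounds hab t).2⟩

/-- `κ` is bounded near `x`, so the interval of radius `ε` around `x` has mass of order `ε`. -/
theorem measure_singleton_eq_zero_of_boundary [IsProbabilityMeasure μ]
    (hκ : ContinuousOn κ {z : ℂ | z.im ≤ 0 ∧ ρ < ‖z‖})
    (hG : ∀ z : ℂ, z.im < 0 → ρ < ‖z‖ → cauchyTransform μ z = κ z) {x : ℝ} (hx : ρ < |x|) :
    μ {x} = 0 := by
  have hopen : IsOpen {x : ℝ | ρ < |x|} := isOpen_lt continuous_const continuous_abs
  obtain ⟨δ, hδ, hball⟩ := Metric.isOpen_iff.1 hopen x hx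
  have hsub : ∀ ε ∈ Ioo 0 δ, ∀ t ∈ Icc (x - ε) (x + ε), ρ < |t| := fun ε hε t ht => by
    refine hball ?_
    rw [Metric.mem_ball, Real.dist_eq, abs_lt]
    constructor <;> linarith [ht.1, ht.2, hε.2]
  have hδ2 : δ / 2 ∈ Ioo 0 δ := ⟨by linarith, by linarith⟩
  obtain ⟨M, hM⟩ := isCompact_Icc.exists_bound_of_continuousOn
    (continuousOn_boundary_zero hκ (hsub _ hδ2))
  have hle : ∀ᶠ ε : ℝ in 𝓝[>] 0, Real.pi * μ.real {x} ≤ M * (2 * ε) := by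
    filter_upwards [Ioc_mem_nhdsGT hδ2.1] with ε hε
    have hε0 : 0 < ε := hε.1
    have h1 := (measureReal_bounds hκ hG (a := x - ε) (b := x + ε) (by linarith)
      (hsub ε ⟨hε0, hε.2.trans_lt hδ2.2⟩)).1
    have h2 : μ.real {x} ≤ μ.real (Ioo (x - ε) (x + ε)) :=
      measureReal_mono (by rw [singleton_subset_iff]; exact ⟨by linarith, by linarith⟩)
    have h3 : ∫ t in (x - ε)..(x + ε), (κ t).im ≤ M * (2 * ε) := by
      refine (le_abs_self _).trans ?_
      refine (intervalIntegral.norm_integral_le_of_norm_le_const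
        (f := fun t : ℝ => (κ t).im) (C := M) fun t ht => ?_).trans ?_
      · rw [uIoc_of_le (by linarith)] at ht
        exact hM t ⟨by linarith [ht.1, hε.2], by linarith [ht.2, hε.2]⟩
      · rw [show x + ε - (x - ε) = 2 * ε by ring, abs_of_pos (by linarith)]
    exact (mul_le_mul_of_nonneg_left h2 Real.pi_pos.le).trans (h1.trans h3)
  have hlim : Tendsto (fun ε : ℝ => M * (2 * ε)) (𝓝[>] 0) (𝓝 0) := by
    have : Continuous fun ε : ℝ => M * (2 * ε) := by fun_prop
    have h := this.tendsto 0
    rw [mul_zero, mul_zero] at h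
    exact h.mono_left nhdsWithin_le_nhds
  have h0 : Real.pi * μ.real {x} ≤ 0 := ge_of_tendsto hlim hle
  have h1 : μ.real {x} = 0 :=
    le_antisymm (nonpos_of_mul_nonpos_right h0 Real.pi_pos) measureReal_nonneg
  rwa [measureReal_eq_zero_iff] at h1

/-- Without atoms at the endpoints, the open- and closed-interval bounds of `measureReal_bounds`
become an equality. -/
theorem measure_Ioc_of_boundary [IsProbabilityMeasure μ]
    (hκ : ContinuousOn κ {z : ℂ | z.im ≤ 0 ∧ ρ < ‖z‖})
    (hG : ∀ z : ℂ, z.im < 0 → ρ < ‖z‖ → cauchyTransform μ z = κ z) {a b : ℝ}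
    (hs : ∀ x ∈ Icc a b, ρ < |x|) :
    μ (Ioc a b) = ∫⁻ x in Ioc a b, ENNReal.ofReal ((κ x).im / Real.pi) := by
  rcases le_or_gt b a with hba | hab
  · simp [Ioc_eq_empty (not_lt.2 hba)]
  have ha : μ {a} = 0 :=
    measure_singleton_eq_zero_of_boundary hκ hG (hs a (left_mem_Icc.2 hab.le))
  have hb : μ {b} = 0 :=
    measure_singleton_eq_zero_of_boundary hκ hG (hs b (right_mem_Icc.2 hab.le))
  obtain ⟨h1, h2⟩ := measureReal_bounds hκ hG hab hs
  rw [measureReal_congr (Ioo_ae_eq_Ioc' hb)] at h1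
  rw [← measureReal_congr (Ioc_ae_eq_Icc' ha)] at h2
  have hint : IntegrableOn (fun x : ℝ => (κ x).im / Real.pi) (Ioc a b) :=
    (((continuousOn_boundary_zero hκ hs).div_const _).integrableOn_Icc).mono_set
      Ioc_subset_Icc_self
  rw [← ofReal_integral_eq_lintegral_ofReal hint, integral_div, ← intervalIntegral.integral_of_le hab.le,
    ← le_antisymm h1 h2, mul_div_cancel_left₀ _ Real.pi_ne_zero, ofReal_measureReal]
  rw [EventuallyLE, ae_restrict_iff' measurableSet_Ioc]
  exact Eventually.of_forall fun x hx =>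
    div_nonneg (im_boundary_nonneg hκ hG (hs x (Ioc_subset_Icc_self hx))) Real.pi_pos.le

/-- Stieltjes inversion where the Cauchy transform extends continuously to the real line. -/
theorem restrict_eq_withDensity_of_boundary [IsProbabilityMeasure μ]
    (hκ : ContinuousOn κ {z : ℂ | z.im ≤ 0 ∧ ρ < ‖z‖})
    (hG : ∀ z : ℂ, z.im < 0 → ρ < ‖z‖ → cauchyTransform μ z = κ z) {R : ℝ} (hR0 : 0 < R)
    (hR : ρ < R) :
    μ.restrict {x : ℝ | R ≤ |x|} = (volume.restrict {x : ℝ | R ≤ |x|}).withDensity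
      fun x => ENNReal.ofReal ((κ x).im / Real.pi) := by
  have hpos : μ.restrict (Ici R) = (volume.restrict (Ici R)).withDensity
      fun x => ENNReal.ofReal ((κ x).im / Real.pi) := by
    have hs0 : μ {R} = 0 := measure_singleton_eq_zero_of_boundary hκ hG (by rwa [abs_of_pos hR0])
    rw [← Measure.restrict_congr_set (Ioi_ae_eq_Ici' hs0),
      ← restrict_Ioi_eq_restrict_Ici (μ := volume)]
    refine Measure.ext_of_Ioc _ _ fun a b _ => ?_
    rw [Measure.restrict_apply measurableSet_Ioc, withDensity_apply _ measurableSet_Ioc,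
      Measure.restrict_restrict measurableSet_Ioc, Ioc_inter_Ioi]
    refine measure_Ioc_of_boundary hκ hG fun x hx => hR.trans_le ?_
    exact (le_sup_right.trans hx.1).trans (le_abs_self x)
  have hneg : μ.restrict (Iic (-R)) = (volume.restrict (Iic (-R))).withDensity
      fun x => ENNReal.ofReal ((κ x).im / Real.pi) := by
    refine Measure.ext_of_Ioc _ _ fun a b _ => ?_
    rw [Measure.restrict_apply measurableSet_Ioc, withDensity_apply _ measurableSet_Ioc,
      Measure.restrict_restrict measurableSet_Ioc, Ioc_inter_Iic]
    refine measure_Ioc_of_boundary hκ hG fun x hx => hR.trans_le ?_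
    have := hx.2.trans inf_le_right
    exact le_abs.2 (Or.inr (by linarith))
  have hdisj : Disjoint (Iic (-R)) (Ici R) := by
    rw [Set.disjoint_left]; intro x hx hx'
    simp only [mem_Iic, mem_Ici] at hx hx'; linarith
  rw [abs_ge_eq_union R, Measure.restrict_union hdisj measurableSet_Ici,
    Measure.restrict_union hdisj measurableSet_Ici, withDensity_add_measure, hpos, hneg]

end Stieltjes

/-! ### The lower branch of the logarithm, and from a Cauchy germ to the tail density. -/

/-- The branch `z ↦ -log (1 / z)` of the logarithm, continuous on the closed lower half-plane
without the origin. -/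
def lowerLog (z : ℂ) : ℂ := -Complex.log z⁻¹

theorem exp_lowerLog {z : ℂ} (hz : z ≠ 0) : Complex.exp (lowerLog z) = z := by
  rw [lowerLog, Complex.exp_neg, Complex.exp_log (inv_ne_zero hz), inv_inv]

theorem re_lowerLog (z : ℂ) : (lowerLog z).re = Real.log ‖z‖ := by
  simp [lowerLog, Complex.log_re]

theorem im_lowerLog_mem (z : ℂ) (hz : z.im ≤ 0) :
    -Real.pi ≤ (lowerLog z).im ∧ (lowerLog z).im ≤ 0 := by
  have h1 : 0 ≤ (z⁻¹).im := by
    rw [Complex.inv_im]; exact div_nonneg (by linarith) (Complex.normSq_nonneg _)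
  have h2 := Complex.arg_nonneg_iff.2 h1
  have h3 := Complex.arg_le_pi z⁻¹
  simp only [lowerLog, Complex.neg_im, Complex.log_im]
  constructor <;> linarith

theorem im_lowerLog_mem_Ioo {z : ℂ} (hz : z.im < 0) :
    -Real.pi < (lowerLog z).im ∧ (lowerLog z).im < 0 := by
  have hz0 : z ≠ 0 := by rintro rfl; simp at hz
  obtain ⟨h1, h2⟩ := im_lowerLog_mem z hz.le
  have h3 := exp_lowerLog hz0
  have him : z.im = Real.exp (lowerLog z).re * Real.sin (lowerLog z).im := by
    rw [← Complex.exp_im, h3]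
  refine ⟨lt_of_le_of_ne h1 fun h => ?_, lt_of_le_of_ne h2 fun h => ?_⟩
  · rw [← h] at him; simp at him; linarith
  · rw [h] at him; simp at him; linarith

theorem lowerLog_eq_log {z : ℂ} (hz : z.im < 0) : lowerLog z = Complex.log z := by
  have hz0 : z ≠ 0 := by rintro rfl; simp at hz
  obtain ⟨h1, h2⟩ := im_lowerLog_mem_Ioo hz
  rw [← Complex.log_exp h1 (by linarith [Real.pi_pos]), exp_lowerLog hz0]

theorem continuousOn_lowerLog : ContinuousOn lowerLog {z : ℂ | z.im ≤ 0 ∧ z ≠ 0} := by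
  have hlog : ContinuousOn Complex.log {z : ℂ | 0 ≤ z.im ∧ z ≠ 0} := by
    rintro z ⟨hz, hz0⟩
    by_cases hs : z ∈ Complex.slitPlane
    · exact (continuousAt_clog hs).continuousWithinAt
    · rw [Complex.mem_slitPlane_iff] at hs
      push Not at hs
      have hre : z.re < 0 := lt_of_le_of_ne hs.1 fun h => hz0 (Complex.ext h hs.2)
      exact (Complex.continuousWithinAt_log_of_re_neg_of_im_zero hre hs.2).mono fun v hv => hv.1
  refine (hlog.comp (ContinuousOn.inv₀ continuousOn_id fun z hz => hz.2) fun z hz => ?_).neg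
  refine ⟨?_, inv_ne_zero hz.2⟩
  show 0 ≤ (z⁻¹).im
  rw [Complex.inv_im]
  exact div_nonneg (by linarith [hz.1]) (Complex.normSq_nonneg _)

theorem continuousOn_comp_expPoint {ι : Type*} [Fintype ι] {a : ι → ℝ} (ha : ∀ i, 0 < a i)
    {g : (ι → ℂ) → ℂ} (hg : AnalyticAt ℂ g 0) :
    ∃ L : ℝ, DifferentiableOn ℂ (fun w => g (expPoint a w)) {w | L < w.re} := by
  have h1 := (tendsto_expPoint ha).eventually hg.eventually_analyticAt
  obtain ⟨L, hL⟩ := eventually_re_iff.1 h1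
  refine ⟨L, fun w hw => ?_⟩
  have h2 : DifferentiableAt ℂ (expPoint a) w := by
    rw [differentiableAt_pi]
    intro i
    simp only [expPoint]
    fun_prop
  exact ((hL w hw).differentiableAt.comp w h2).differentiableWithinAt

/-- A gap above `0` lets a multiplicative constant in a coefficient bound be absorbed into the base
`r` of `r ^ β`, as the class `MemP` allows no such constant. -/
theorem exists_min_pos_natSpan {ι : Type*} [Fintype ι] {a : ι → ℝ} (ha : ∀ i, 0 < a i) :
    ∃ m : ℝ, 0 < m ∧ ∀ γ ∈ natSpan a, 0 < γ → m ≤ γ := by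
  rcases isEmpty_or_nonempty ι with hι | hι
  · refine ⟨1, one_pos, ?_⟩
    rintro _ ⟨n, rfl⟩ h
    simp at h
  · obtain ⟨i₀, hi₀⟩ := Finite.exists_min a
    refine ⟨a i₀, ha i₀, ?_⟩
    rintro _ ⟨n, rfl⟩ hpos
    obtain ⟨i, -, hi⟩ := Finset.exists_ne_zero_of_sum_ne_zero hpos.ne'
    have hn : (1 : ℝ) ≤ n i := by
      have : n i ≠ 0 := by rintro h; simp [h] at hi
      exact_mod_cast Nat.one_le_iff_ne_zero.2 this
    calc a i₀ ≤ a i := hi₀ i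
      _ ≤ n i * a i := le_mul_of_one_le_left (ha i).le hn
      _ ≤ _ := Finset.single_le_sum (f := fun i => (n i : ℝ) * a i)
          (fun j _ => mul_nonneg (Nat.cast_nonneg _) (ha j).le) (Finset.mem_univ i)

theorem memP_of_hasCauchyGerm {ι : Type*} [Fintype ι] {a : ι → ℝ} (ha : ∀ i, 0 < a i) {c : ℝ}
    (hc : 0 < c) (μ : Measure ℝ) [IsProbabilityMeasure μ] (hμ : HasCauchyGerm a μ) :
    MemP (natSpan a) c μ := by
  classical
  obtain ⟨g, hg, hg1, L₁, hL₁⟩ := hμ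
  obtain ⟨L₂, hL₂⟩ := continuousOn_comp_expPoint ha hg
  obtain ⟨f, C, B, hC, hB, hfb, hf0, hf⟩ := exists_coeff_of_analyticAt ha hg
  obtain ⟨L₃, hL₃⟩ := eventually_re_iff.1 hf
  obtain ⟨m, hm, hmS⟩ := exists_min_pos_natSpan ha
  set L := max L₁ (max L₂ L₃) with hL
  have hLL₁ : L₁ ≤ L := le_max_left _ _
  have hLL₂ : L₂ ≤ L := (le_max_left _ _).trans (le_max_right _ _)
  have hLL₃ : L₃ ≤ L := (le_max_right _ _).trans (le_max_right _ _)
  set ρ := Real.exp L with hρ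
  have hρ0 : 0 < ρ := Real.exp_pos _
  have hlogρ : ∀ z : ℂ, ρ < ‖z‖ → L < (lowerLog z).re := fun z hz => by
    rw [re_lowerLog, Real.lt_log_iff_exp_lt (hρ0.trans hz)]
    exact hz
  have hne : ∀ z : ℂ, ρ < ‖z‖ → z ≠ 0 := fun z hz => norm_pos_iff.1 (hρ0.trans hz)
  let κ : ℂ → ℂ := fun z => Complex.exp (-lowerLog z) * g (expPoint a (lowerLog z))
  have hκ : ContinuousOn κ {z : ℂ | z.im ≤ 0 ∧ ρ < ‖z‖} := by
    have hlc : ContinuousOn lowerLog {z : ℂ | z.im ≤ 0 ∧ ρ < ‖z‖} :=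
      continuousOn_lowerLog.mono fun z hz => ⟨hz.1, hne z hz.2⟩
    refine ContinuousOn.mul (Complex.continuous_exp.comp_continuousOn hlc.neg) ?_
    exact hL₂.continuousOn.comp hlc fun z hz => hLL₂.trans_lt (hlogρ z hz.2)
  have hG : ∀ z : ℂ, z.im < 0 → ρ < ‖z‖ → cauchyTransform μ z = κ z := fun z hz hz' => by
    obtain ⟨h1, h2⟩ := im_lowerLog_mem_Ioo hz
    have h3 := hL₁ _ (hLL₁.trans_lt (hlogρ z hz')) h1 h2
    rwa [exp_lowerLog (hne z hz')] at h3
  -- For `β ≥ m` the second factor to the power `β` is at least `C`, so `C * B ^ β ≤ r ^ β`.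
  set r : ℝ := B * (max C 1) ^ (1 / m) with hr
  have hr0 : 0 < r := by positivity
  set R : ℝ := c * r + ρ + 1 with hR
  have hρR : ρ < R := by have : 0 < c * r := by positivity
                         linarith
  have hR0 : 0 < R := hρ0.trans hρR
  have hdens : ∀ x : ℝ, R ≤ |x| →
      tailDensity (natSpan a) (fun γ => f γ / Real.pi) x = (κ x).im / Real.pi := by
    intro x hx
    have hx' : ρ < ‖(x : ℂ)‖ := by rw [Complex.norm_real]; exact hρR.trans_le hx
    set w := lowerLog (x : ℂ) with hw
    have hexp : Complex.exp w = x := exp_lowerLog (hne _ hx')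
    obtain ⟨him1, him2⟩ := im_lowerLog_mem (x : ℂ) (by simp)
    have hs := hL₃ w (hLL₃.trans_lt (hlogρ _ hx'))
    let b : ℝ → ℂ := fun γ => if 0 < γ then f γ / Real.pi else 0
    have hs2 : HasSum (fun γ : natSpan a => b γ * Complex.exp (-((γ : ℝ) : ℂ) * w))
        (g (expPoint a w) / Real.pi - 1 / Real.pi) := by
      have h1 := (hs.div_const (Real.pi : ℂ)).sub
        (hasSum_ite_eq (⟨0, zero_mem_natSpan a⟩ : natSpan a) (1 / (Real.pi : ℂ)))
      refine (congrArg (fun u => HasSum u (g (expPoint a w) / Real.pi - 1 / Real.pi))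
        (funext fun γ => ?_)).mp h1
      by_cases hγ : γ = ⟨0, zero_mem_natSpan a⟩
      · subst hγ
        simp [b, hf0, hg1]
      · have hγ0 : (γ : ℝ) ≠ 0 := fun h => hγ (Subtype.ext h)
        have hγpos : (0 : ℝ) < γ := lt_of_le_of_ne (natSpan_nonneg ha γ.2) hγ0.symm
        simp only [b, if_neg hγ, if_pos hγpos]
        ring
    rw [tailDensity_eq_im (b := b) (fun γ _ h => if_pos h) (fun γ h => if_neg h) hexp.symm him1
      (by linarith [Real.pi_pos]) hs2.summable, hs2.tsum_eq]
    have h3 : Complex.exp (-w) = ((1 / x : ℝ) : ℂ) := by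
      rw [Complex.exp_neg, hexp]; push_cast; rw [one_div]
    -- The leading term of the germ contributes `1 / (π * x)`, which is real on the axis and
    -- disappears from the imaginary part. Dropping the exponent `0` thus leaves the density
    -- unchanged.
    have h4 : Complex.exp (-w) * (g (expPoint a w) / Real.pi - 1 / Real.pi) =
        ((1 / Real.pi : ℝ) : ℂ) * κ x - ((1 / x * (1 / Real.pi) : ℝ) : ℂ) := by
      simp only [κ, ← hw, h3]
      push_cast
      ring
    rw [h4, Complex.sub_im, Complex.im_ofReal_mul, Complex.ofReal_im]
    ring
  have hms : MeasurableSet {x : ℝ | R ≤ |x|} := measurableSet_le measurable_const measurable_id.abs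
  refine ⟨fun γ => f γ / Real.pi, r, R, hr0, hR0, ?_, ?_, ?_, ?_⟩
  · intro β hβ hβ0
    rw [norm_div, Complex.norm_real, Real.norm_of_nonneg Real.pi_pos.le]
    have h1 : C ≤ ((max C 1) ^ (1 / m)) ^ β := by
      rw [← Real.rpow_mul (by positivity)]
      refine (le_max_left C 1).trans ?_
      refine (Real.rpow_one _).symm.le.trans
        (Real.rpow_le_rpow_of_exponent_le (le_max_right _ _) ?_)
      rw [one_div, ← div_eq_inv_mul, one_le_div hm]
      exact hmS β hβ hβ0
    calc ‖f β‖ / Real.pi ≤ ‖f β‖ :=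
          div_le_self (norm_nonneg _) (by linarith [Real.pi_gt_three])
      _ ≤ C * B ^ β := hfb β hβ
      _ ≤ ((max C 1) ^ (1 / m)) ^ β * B ^ β := by gcongr
      _ = r ^ β := by rw [hr, Real.mul_rpow hB.le (by positivity), mul_comm]
  · rw [← div_eq_inv_mul, lt_div_iff₀ hc]
    rw [hR]; linarith
  · rw [ae_restrict_iff' hms]
    refine Eventually.of_forall fun x hx => ?_
    rw [hdens x hx]
    exact div_nonneg (im_boundary_nonneg hκ hG (hρR.trans_le hx)) Real.pi_pos.le
  · rw [restrict_eq_withDensity_of_boundary hκ hG hR0 hρR]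
    refine withDensity_congr_ae ?_
    rw [EventuallyEq, ae_restrict_iff' hms]
    exact Eventually.of_forall fun x hx => by rw [hdens x hx]

/-! ### Between Cauchy germs and Voiculescu transforms. -/

/-- In the narrower cone `‖z‖` is at most a constant times `-Im z`, so a small relative perturbation
costs only a small fraction of the height. The tolerance does not depend on `M`. -/
theorem exists_mul_mem_truncatedCone {η : ℝ} (hη : 0 < η) :
    ∃ ε : ℝ, 0 < ε ∧ ∀ (M : ℝ) (z ζ : ℂ), 0 < M → z ∈ truncatedCone (2 * η) (2 * M) →
      ‖ζ - 1‖ < ε → z * ζ ∈ truncatedCone η M := by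
  set k : ℝ := 1 + 1 / (2 * η) with hk
  have hk0 : 0 < k := by positivity
  refine ⟨1 / (4 * k * (1 + η)), by positivity, fun M z ζ hM hz hζ => ?_⟩
  obtain ⟨h1, h2⟩ := hz
  set y := -z.im with hy
  have hy0 : 0 < y := by linarith
  have hx : |z.re| ≤ y / (2 * η) := by
    rw [le_div_iff₀ (by positivity)]; linarith
  have hnorm : ‖z‖ ≤ k * y := by
    have h3 := Complex.norm_le_abs_re_add_abs_im z
    have h4 : |z.im| = y := by rw [hy, abs_of_neg (by linarith)]
    have h5 : k * y = y + y / (2 * η) := by rw [hk]; field_simp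
    linarith
  have hdiff : ‖z * ζ - z‖ ≤ y / (4 * (1 + η)) := by
    rw [show z * ζ - z = z * (ζ - 1) by ring, norm_mul]
    calc ‖z‖ * ‖ζ - 1‖ ≤ k * y * (1 / (4 * k * (1 + η))) := by gcongr
      _ = y / (4 * (1 + η)) := by field_simp
  set δ := y / (4 * (1 + η)) with hδ
  have hδ0 : 0 < δ := by positivity
  have hδy : δ * (4 * (1 + η)) = y := by rw [hδ]; field_simp
  have him := (Complex.abs_im_le_norm (z * ζ - z)).trans hdiff
  have hre := (Complex.abs_re_le_norm (z * ζ - z)).trans hdiff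
  rw [Complex.sub_im, abs_le] at him
  rw [Complex.sub_re] at hre
  have hre' : |(z * ζ).re| ≤ y / (2 * η) + δ := by
    calc |(z * ζ).re| = |((z * ζ).re - z.re) + z.re| := by rw [sub_add_cancel]
      _ ≤ |(z * ζ).re - z.re| + |z.re| := abs_add_le _ _
      _ ≤ _ := by linarith
  have hηy : η * (y / (2 * η)) = y / 2 := by field_simp
  have h6 : η * |(z * ζ).re| ≤ y / 2 + η * δ := by
    calc _ ≤ η * (y / (2 * η) + δ) := by gcongr
      _ = _ := by rw [mul_add, hηy]
  have hηδ : 0 < η * δ := by positivity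
  constructor
  · nlinarith [him.1, him.2]
  · nlinarith [him.1, him.2]

/-- This keeps a shifted point `w + u` with `‖u‖ < 1` on the right sheet: the sign of the
exponential decides the strip. -/
theorem im_mem_Ioo_of_im_exp_neg {w : ℂ} (h1 : -(2 * Real.pi) < w.im) (h2 : w.im < Real.pi)
    (h : (Complex.exp w).im < 0) : -Real.pi < w.im ∧ w.im < 0 := by
  rw [Complex.exp_im] at h
  have hs : Real.sin w.im < 0 := by
    by_contra hcon
    push Not at hcon
    have := mul_nonneg (Real.exp_pos w.re).le hcon
    linarith
  constructor
  · by_contra hcon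
    push Not at hcon
    have h3 := Real.sin_nonneg_of_nonneg_of_le_pi (x := w.im + 2 * Real.pi) (by linarith)
      (by linarith)
    rw [Real.sin_add_two_pi] at h3
    linarith
  · by_contra hcon
    push Not at hcon
    have h3 := Real.sin_nonneg_of_nonneg_of_le_pi hcon h2.le
    linarith

theorem truncatedCone_im_neg {η M : ℝ} (hM : 0 < M) {z : ℂ} (hz : z ∈ truncatedCone η M) :
    z.im < 0 := by linarith [hz.1]

theorem truncatedCone_lt_norm {η M : ℝ} {z : ℂ} (hz : z ∈ truncatedCone η M) : M < ‖z‖ := by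
  have h := (neg_le_abs _).trans (Complex.abs_im_le_norm z)
  linarith [hz.1]

theorem log_re_gt {L : ℝ} {z : ℂ} (hz : Real.exp L < ‖z‖) : L < (Complex.log z).re := by
  rw [Complex.log_re, Real.lt_log_iff_exp_lt ((Real.exp_pos _).trans hz)]
  exact hz

theorem log_im_mem_Ioo {z : ℂ} (hz : z.im < 0) :
    -Real.pi < (Complex.log z).im ∧ (Complex.log z).im < 0 := by
  rw [← lowerLog_eq_log hz]; exact im_lowerLog_mem_Ioo hz

theorem div_cpow_eq {z : ℂ} (hz : z ≠ 0) (b : ℂ) (γ : ℝ) :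
    b / z ^ (γ : ℂ) = b * Complex.exp (-(γ : ℂ) * Complex.log z) := by
  rw [Complex.cpow_def_of_ne_zero hz, div_eq_mul_inv, ← Complex.exp_neg]
  ring_nf

section

variable {ι : Type*} {a : ι → ℝ}

theorem tendsto_pair_comap {X : Type*} {l : Filter X} {u : X → ι → ℂ} {v : X → ℂ}
    {P : (ι → ℂ) × ℂ → Prop} (hP : ∀ᶠ q in 𝓝 ((0 : ι → ℂ), (0 : ℂ)), P q)
    (hu : Tendsto u l (𝓝 0)) (hv : Tendsto v l (𝓝 0)) : ∀ᶠ x in l, P (u x, v x) :=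
  (hu.prodMk_nhds hv).eventually hP

/-- In logarithmic coordinates the transform is `w ↦ w + l` with `l = log E`, and the inversion germ
`U` recovers `l` from `w + l`. This gives injectivity on a whole half-plane outside a disc, not just
in a cone. -/
theorem injOn_reciprocalCauchy_of_germ [Fintype ι] (ha : ∀ i, 0 < a i) {μ : Measure ℝ}
    {E : (ι → ℂ) → ℂ} (hE : AnalyticAt ℂ E 0) (hE0 : E 0 = 1) {L : ℝ}
    (hF : ∀ w : ℂ, L < w.re → -Real.pi < w.im → w.im < 0 →
      reciprocalCauchy μ (Complex.exp w) = Complex.exp w * E (expPoint a w)) :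
    ∃ ρ : ℝ, ∀ ρ' ≥ ρ, InjOn (reciprocalCauchy μ) (lowerOutside ρ') := by
  obtain ⟨U, -, -, hU⟩ := exists_analyticAt_inversion a hE hE0
  obtain ⟨δ, hδ, hball⟩ := Metric.eventually_nhds_iff_ball.1 hU
  have hs := tendsto_expPoint ha
  obtain ⟨L₁, hL₁⟩ := eventually_re_iff.1 (hs.eventually (Metric.ball_mem_nhds _ hδ))
  have hEs : Tendsto (fun w => E (expPoint a w)) (comap Complex.re atTop) (𝓝 1) := by
    rw [← hE0]; exact hE.continuousAt.tendsto.comp hs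
  have hlog : Tendsto (fun w => Complex.log (E (expPoint a w))) (comap Complex.re atTop) (𝓝 0) := by
    rw [← Complex.log_one]
    exact (continuousAt_clog (by simp)).tendsto.comp hEs
  obtain ⟨L₂, hL₂⟩ := eventually_re_iff.1 ((hlog.eventually
    (Metric.ball_mem_nhds _ (lt_min hδ one_pos))).and (hEs.eventually_ne one_ne_zero))
  set L₃ := max L (max L₁ L₂) + 1 with hL₃
  have e1 : L ≤ L₃ - 1 := by rw [hL₃, add_sub_cancel_right]; exact le_max_left _ _
  have e2 : L₁ ≤ L₃ - 1 := by
    rw [hL₃, add_sub_cancel_right]; exact (le_max_left _ _).trans (le_max_right _ _)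
  have e3 : L₂ ≤ L₃ - 1 := by
    rw [hL₃, add_sub_cancel_right]; exact (le_max_right _ _).trans (le_max_right _ _)
  -- the logarithm of the reciprocal Cauchy transform determines the point
  have key : ∀ w : ℂ, L₃ < w.re →
      ‖Complex.log (E (expPoint a w))‖ < 1 ∧
      Complex.exp (w + Complex.log (E (expPoint a w))) = Complex.exp w * E (expPoint a w) ∧
      U (expPoint a (w + Complex.log (E (expPoint a w)))) = -Complex.log (E (expPoint a w)) := by
    intro w hw
    obtain ⟨h1, h2⟩ := hL₂ w (by linarith)
    rw [dist_zero_right, lt_min_iff] at h1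
    set l := Complex.log (E (expPoint a w)) with hl
    have hexpl : Complex.exp l = E (expPoint a w) := Complex.exp_log h2
    refine ⟨h1.2, by rw [Complex.exp_add, hexpl], ?_⟩
    have hre : L₁ < (w + l).re := by
      have := (Complex.abs_re_le_norm l).trans_lt h1.2
      rw [abs_lt] at this
      rw [Complex.add_re]; linarith [this.1]
    have hmem : (expPoint a (w + l), -l) ∈ Metric.ball ((0 : ι → ℂ), (0 : ℂ)) δ := by
      rw [← ball_prod_same]
      exact ⟨hL₁ _ hre, by rw [mem_ball_zero_iff, norm_neg]; exact h1.1⟩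
    refine (hball _ hmem).1 ?_
    have h3 := expPoint_add a (w + l) (-l)
    rw [add_neg_cancel_right] at h3
    simp only
    rw [← h3, ← hexpl, ← Complex.exp_add, neg_add_cancel, Complex.exp_zero]
  refine ⟨Real.exp L₃, fun ρ' hρ' z₁ hz₁ z₂ hz₂ hzz => ?_⟩
  have prep : ∀ z ∈ lowerOutside ρ', L₃ < (Complex.log z).re ∧ -Real.pi < (Complex.log z).im ∧
      (Complex.log z).im < 0 ∧ Complex.exp (Complex.log z) = z := fun z hz => by
    have hn : Real.exp L₃ < ‖z‖ := lt_of_le_of_lt hρ' hz.2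
    exact ⟨log_re_gt hn, (log_im_mem_Ioo hz.1).1, (log_im_mem_Ioo hz.1).2,
      Complex.exp_log (norm_pos_iff.1 ((Real.exp_pos _).trans hn))⟩
  obtain ⟨p1, p2, p3, p4⟩ := prep z₁ hz₁
  obtain ⟨q1, q2, q3, q4⟩ := prep z₂ hz₂
  set w₁ := Complex.log z₁
  set w₂ := Complex.log z₂
  obtain ⟨k1, k2, k3⟩ := key w₁ p1
  obtain ⟨m1, m2, m3⟩ := key w₂ q1
  set l₁ := Complex.log (E (expPoint a w₁))
  set l₂ := Complex.log (E (expPoint a w₂))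
  have hexp : Complex.exp (w₁ + l₁) = Complex.exp (w₂ + l₂) := by
    rw [k2, m2, ← hF w₁ (by linarith) p2 p3, ← hF w₂ (by linarith) q2 q3, p4, q4, hzz]
  -- The imaginary parts of `w₁`, `w₂` differ by less than `π` and the corrections by less than `2`;
  -- as `π + 2 < 2 * π`, no nonzero period fits.
  have hw : w₁ + l₁ = w₂ + l₂ := by
    obtain ⟨n, hn⟩ := Complex.exp_eq_exp_iff_exists_int.1 hexp
    have him : (w₁ + l₁).im - (w₂ + l₂).im = n * (2 * Real.pi) := by rw [hn]; simp
    rw [Complex.add_im, Complex.add_im] at him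
    have b1 := abs_lt.1 ((Complex.abs_im_le_norm l₁).trans_lt k1)
    have b2 := abs_lt.1 ((Complex.abs_im_le_norm l₂).trans_lt m1)
    have hpi := Real.pi_gt_three
    have hn0 : n = 0 := by
      have c1 : (n : ℝ) < 1 := by nlinarith [b1.1, b1.2, b2.1, b2.2]
      have c2 : (-1 : ℝ) < n := by nlinarith [b1.1, b1.2, b2.1, b2.2]
      have c3 : n < 1 := by exact_mod_cast c1
      have c4 : -1 < n := by exact_mod_cast c2
      omega
    rw [hn0] at hn
    simpa using hn
  have hl : l₁ = l₂ := by
    rw [hw, m3] at k3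
    exact (neg_injective k3).symm
  have hww : w₁ = w₂ := by
    rw [hl] at hw
    exact add_right_cancel hw
  rw [← p4, ← q4, hww]

/-- Expansion of the Voiculescu transform from a germ of the Cauchy transform. -/
theorem exists_voiculescuTransform_of_hasCauchyGerm [Fintype ι] (ha : ∀ i, 0 < a i) {c : ℝ} (hc : 0 < c)
    (μ : Measure ℝ) (hμ : HasCauchyGerm a μ) :
    ∃ (e : ℝ → ℂ) (A : ℝ), 0 < A ∧ (∀ γ ∈ natSpan a, ‖e γ‖ ≤ A ^ (γ + 1)) ∧
      ∃ φ : ℂ → ℂ, IsVoiculescuTransform μ (lowerOutside (c * A)) φ ∧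
        ∀ z ∈ lowerOutside (c * A),
          HasSum (fun γ : natSpan a => z * (e γ / z ^ ((γ : ℝ) : ℂ))) (φ z) := by
  obtain ⟨g, hg, hg1, L, hL⟩ := hμ
  let E : (ι → ℂ) → ℂ := fun s => (g s)⁻¹
  have hE : AnalyticAt ℂ E 0 := hg.inv (by rw [hg1]; exact one_ne_zero)
  have hE0 : E 0 = 1 := by simp [E, hg1]
  have hF : ∀ w : ℂ, L < w.re → -Real.pi < w.im → w.im < 0 →
      reciprocalCauchy μ (Complex.exp w) = Complex.exp w * E (expPoint a w) := fun w h1 h2 h3 => by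
    rw [reciprocalCauchy, hL w h1 h2 h3, Complex.exp_neg, one_div, mul_inv, inv_inv]
  obtain ⟨U, hU, hU0, hUiff⟩ := exists_analyticAt_inversion a hE hE0
  obtain ⟨ρ, hinj⟩ := injOn_reciprocalCauchy_of_germ ha hE hE0 hF
  -- The inverse is `exp (w + U) = z * exp U`; subtracting `z` leaves `z * V`.
  let V : (ι → ℂ) → ℂ := fun s => Complex.exp (U s) - 1
  have hV : AnalyticAt ℂ V 0 := hU.cexp.sub analyticAt_const
  have hV0 : V 0 = 0 := by simp [V, hU0]
  obtain ⟨f, C, B, hC, hB, hfb, -, hf⟩ := exists_coeff_of_analyticAt ha hV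
  obtain ⟨L₁, hL₁⟩ := eventually_re_iff.1 hf
  obtain ⟨L₂, hL₂⟩ := continuousOn_comp_expPoint ha hV
  obtain ⟨ε, hε, hcone⟩ := exists_mul_mem_truncatedCone one_pos
  have hs := tendsto_expPoint ha
  have hUs : Tendsto (fun w => U (expPoint a w)) (comap Complex.re atTop) (𝓝 0) := by
    rw [← hU0]; exact hU.continuousAt.tendsto.comp hs
  have hVs : Tendsto (fun w => V (expPoint a w)) (comap Complex.re atTop) (𝓝 0) := by
    rw [← hV0]; exact hV.continuousAt.tendsto.comp hs
  obtain ⟨L₃, hL₃⟩ := eventually_re_iff.1 ((tendsto_pair_comap hUiff hs hUs).and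
    ((hUs.eventually (Metric.ball_mem_nhds _ one_pos)).and
      (hVs.eventually (Metric.ball_mem_nhds _ hε))))
  set X := max (L + 1) (max L₁ (max L₂ L₃)) with hX
  have x0 : L + 1 ≤ X := le_max_left _ _
  have x1 : L₁ ≤ X := (le_max_left _ _).trans (le_max_right _ _)
  have x2 : L₂ ≤ X := (le_max_left _ _).trans ((le_max_right _ _).trans (le_max_right _ _))
  have x3 : L₃ ≤ X := (le_max_right _ _).trans ((le_max_right _ _).trans (le_max_right _ _))
  -- `A ≥ C, B` turns `C * B ^ γ` into `A ^ (γ + 1)`, and `c * A ≥ exp X` puts the region inside the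
  -- domain of all expansions.
  set A := max (max C B) (Real.exp X / c) with hA
  have hAC : C ≤ A := (le_max_left _ _).trans (le_max_left _ _)
  have hAB : B ≤ A := (le_max_right _ _).trans (le_max_left _ _)
  have hA0 : 0 < A := hC.trans_le hAC
  have hcA : Real.exp X ≤ c * A := by
    rw [← div_le_iff₀' hc]; exact le_max_right _ _
  have hcA0 : 0 < c * A := by positivity
  have prep : ∀ z ∈ lowerOutside (c * A), z ≠ 0 ∧ X < (Complex.log z).re ∧
      Complex.exp (Complex.log z) = z := fun z hz => by
    have hn : Real.exp X < ‖z‖ := lt_of_le_of_lt hcA hz.2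
    have hz0 : z ≠ 0 := norm_pos_iff.1 ((Real.exp_pos _).trans hn)
    exact ⟨hz0, log_re_gt hn, Complex.exp_log hz0⟩
  set M := max (c * A) ρ with hM
  have hM0 : 0 < M := hcA0.trans_le (le_max_left _ _)
  refine ⟨f, A, hA0, fun γ hγ => ?_, fun z => z * V (expPoint a (Complex.log z)), ⟨?_, ?_⟩, ?_⟩
  · have hγ0 := natSpan_nonneg ha hγ
    rw [Real.rpow_add hA0, Real.rpow_one, mul_comm]
    refine (hfb γ hγ).trans ?_
    gcongr
  · intro z hz
    obtain ⟨hz0, hre, -⟩ := prep z hz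
    have hslit : z ∈ Complex.slitPlane := Or.inr hz.1.ne
    have hd : DifferentiableAt ℂ (fun w => V (expPoint a w)) (Complex.log z) :=
      hL₂.differentiableAt ((isOpen_lt continuous_const Complex.continuous_re).mem_nhds
        (x2.trans_lt hre))
    exact (differentiableAt_id.mul
      (hd.comp z (Complex.differentiableAt_log hslit))).differentiableWithinAt
  · refine ⟨2 * 1, 2 * M, 1, M, by norm_num, by positivity, one_pos, hM0, ?_, ?_, ?_⟩
    · intro z hz
      refine ⟨truncatedCone_im_neg (by positivity) hz, ?_⟩
      have h1 := truncatedCone_lt_norm hz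
      have h2 : c * A ≤ M := le_max_left _ _
      linarith
    · exact (hinj M (le_max_right _ _)).mono (show truncatedCone 1 M ⊆ lowerOutside M from
        fun z hz => ⟨truncatedCone_im_neg hM0 hz, truncatedCone_lt_norm hz⟩)
    · intro z hz
      have hz_im : z.im < 0 := truncatedCone_im_neg (by positivity) hz
      have hzo : z ∈ lowerOutside (c * A) := by
        refine ⟨hz_im, ?_⟩
        have h1 := truncatedCone_lt_norm hz
        have h2 : c * A ≤ M := le_max_left _ _
        linarith
      obtain ⟨hz0, hre, hexp⟩ := prep z hzo
      obtain ⟨him1, him2⟩ := log_im_mem_Ioo hz_im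
      set w := Complex.log z
      obtain ⟨hiff, hu1, hv1⟩ := hL₃ w (x3.trans_lt hre)
      rw [dist_zero_right] at hu1 hv1
      set u := U (expPoint a w) with hu
      have hsum : z + z * V (expPoint a w) = z * Complex.exp u := by
        simp only [V, ← hu]; ring
      have hmem : z * Complex.exp u ∈ truncatedCone 1 M := hcone M z _ hM0 hz hv1
      have hexp2 : z * Complex.exp u = Complex.exp (w + u) := by rw [Complex.exp_add, hexp]
      show z + z * V (expPoint a w) ∈ truncatedCone 1 M ∧
        reciprocalCauchy μ (z + z * V (expPoint a w)) = z
      rw [hsum]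
      refine ⟨hmem, ?_⟩
      rw [hexp2] at hmem ⊢
      have b1 := abs_lt.1 ((Complex.abs_im_le_norm u).trans_lt hu1)
      have b2 := abs_lt.1 ((Complex.abs_re_le_norm u).trans_lt hu1)
      have hpi := Real.pi_gt_three
      obtain ⟨i1, i2⟩ := im_mem_Ioo_of_im_exp_neg (w := w + u)
        (by rw [Complex.add_im]; linarith [b1.1]) (by rw [Complex.add_im]; linarith [b1.2])
        (truncatedCone_im_neg hM0 hmem)
      rw [hF (w + u) (by rw [Complex.add_re]; linarith [b2.1]) i1 i2, Complex.exp_add, mul_assoc,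
        expPoint_add]
      have := hiff.2 rfl
      simp only at this
      rw [this, mul_one, hexp]
  · intro z hz
    obtain ⟨hz0, hre, -⟩ := prep z hz
    have h1 := (hL₁ (Complex.log z) (x1.trans_lt hre)).mul_left z
    simpa only [div_cpow_eq hz0] using h1

theorem exp_sub_pi_div_two (x : ℝ) :
    Complex.exp (x - Real.pi / 2 * Complex.I) = ⟨0, -Real.exp x⟩ := by
  rw [Complex.exp_eq_exp_re_mul_sin_add_cos]
  apply Complex.ext <;> simp [Complex.exp_ofReal_re]

theorem exp_sub_pi_div_two_mem_truncatedCone {η M x : ℝ} (hx : M < Real.exp x) :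
    Complex.exp (x - Real.pi / 2 * Complex.I) ∈ truncatedCone η M := by
  rw [exp_sub_pi_div_two]
  exact ⟨by simpa using hx, by simp [Real.exp_pos]⟩

theorem tendsto_re_line : Tendsto (fun x : ℝ => (x : ℂ) - Real.pi / 2 * Complex.I) atTop
    (comap Complex.re atTop) := by
  rw [tendsto_comap_iff]
  exact tendsto_id.congr fun x => by simp

/-- The constant coefficient in the expansion of a Voiculescu transform vanishes. -/
theorem voiculescuTransform_germ_zero (ha : ∀ i, 0 < a i) (μ : Measure ℝ) [IsProbabilityMeasure μ]
    {D : Set ℂ} {φ : ℂ → ℂ} (hφ : IsVoiculescuTransform μ D φ) {V : (ι → ℂ) → ℂ}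
    (hV : ContinuousAt V 0) {L : ℝ} (h : ∀ w : ℂ, L < w.re → -Real.pi < w.im → w.im < 0 →
      φ (Complex.exp w) = Complex.exp w * V (expPoint a w)) : V 0 = 0 := by
  obtain ⟨-, η, M, η', M', hη, hM, hη', hM', -, -, hinv⟩ := hφ
  obtain ⟨K, hK, hbound⟩ := exists_le_im_cauchyTransform μ
  let z : ℝ → ℂ := fun x => Complex.exp (x - Real.pi / 2 * Complex.I)
  let ω : ℝ → ℂ := fun x => z x + φ (z x)
  have hnz : ∀ x, ‖z x‖ = Real.exp x := fun x => by simp [z, Complex.norm_exp]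
  have hz0 : ∀ x, z x ≠ 0 := fun x => Complex.exp_ne_zero _
  have hev : ∀ᶠ x in atTop, ω x ∈ truncatedCone η' M' ∧ reciprocalCauchy μ (ω x) = z x := by
    filter_upwards [Real.tendsto_exp_atTop.eventually_gt_atTop M] with x hx
    exact hinv _ (exp_sub_pi_div_two_mem_truncatedCone hx)
  have hGz : ∀ x, reciprocalCauchy μ (ω x) = z x → cauchyTransform μ (ω x) = (z x)⁻¹ := by
    intro x hx
    rw [← hx, reciprocalCauchy, one_div, inv_inv]
  -- `ω x` stays below height `-M'` while the Cauchy transform there has modulus `exp (-x)`; the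
  -- lower bound on its imaginary part forces `‖ω x‖` to grow at least like `exp (x / 2)`.
  have hnorm : Tendsto (fun x => ‖ω x‖) atTop atTop := by
    have h1 : Tendsto (fun x : ℝ => Real.sqrt (M' / 2 * Real.exp x) - K) atTop atTop :=
      tendsto_atTop_add_const_right _ _ (Real.tendsto_sqrt_atTop.comp
        (Real.tendsto_exp_atTop.const_mul_atTop (by positivity)))
    refine tendsto_atTop_mono' _ ?_ h1
    filter_upwards [hev] with x hx
    have him := truncatedCone_im_neg hM' hx.1
    have h2 := (hbound _ him).trans ((le_abs_self _).trans (Complex.abs_im_le_norm _))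
    rw [hGz x hx.2, norm_inv, hnz] at h2
    have h3 : M' / (2 * (‖ω x‖ + K) ^ 2) ≤ (Real.exp x)⁻¹ := by
      refine le_trans ?_ h2
      gcongr
      linarith [hx.1.1]
    have h4 : M' / 2 * Real.exp x ≤ (‖ω x‖ + K) ^ 2 := by
      rw [div_le_iff₀ (by positivity), ← div_eq_inv_mul, le_div_iff₀ (Real.exp_pos _)] at h3
      linarith
    have h5 := Real.sqrt_le_sqrt h4
    rw [Real.sqrt_sq (by positivity)] at h5
    linarith
  have hlim : Tendsto (fun x => ω x * cauchyTransform μ (ω x)) atTop (𝓝 1) := by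
    refine (tendsto_mul_cauchyTransform μ hη').comp (tendsto_inf.2 ⟨tendsto_comap_iff.2 hnorm,
      tendsto_principal.2 ?_⟩)
    filter_upwards [hev] with x hx
    exact hx.1.2
  have hlim2 : Tendsto (fun x : ℝ => 1 + V (expPoint a (x - Real.pi / 2 * Complex.I))) atTop
      (𝓝 (1 + V 0)) :=
    (hV.tendsto.comp ((tendsto_expPoint ha).comp tendsto_re_line)).const_add 1
  -- Since the Cauchy transform at `ω` is `1 / z`, the product `ω * G(ω)` equals `(z + φ z) / z = 1
  -- + V`, and its limit is `1`.
  have huniq := tendsto_nhds_unique hlim2 (hlim.congr' ?_)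
  · simpa using huniq
  · filter_upwards [hev, eventually_gt_atTop L] with x hx hxL
    rw [hGz x hx.2]
    have h1 := h (x - Real.pi / 2 * Complex.I) (by simpa using hxL)
      (by simp; linarith [Real.pi_pos]) (by simp; linarith [Real.pi_pos])
    have h2 := hz0 x
    simp only [ω]
    rw [show φ (z x) = z x * V (expPoint a (x - Real.pi / 2 * Complex.I)) from h1]
    field_simp

/-- A germ of the Cauchy transform from an expansion of the Voiculescu transform. -/
theorem hasCauchyGerm_of_voiculescuTransform [Fintype ι] (ha : ∀ i, 0 < a i) {c A : ℝ} (hA : 0 < A)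
    (μ : Measure ℝ) [IsProbabilityMeasure μ] {e : ℝ → ℂ}
    (he : ∀ γ ∈ natSpan a, ‖e γ‖ ≤ A ^ (γ + 1)) {φ : ℂ → ℂ}
    (hφ : IsVoiculescuTransform μ (lowerOutside (c * A)) φ)
    (hsum : ∀ z ∈ lowerOutside (c * A),
      HasSum (fun γ : natSpan a => z * (e γ / z ^ ((γ : ℝ) : ℂ))) (φ z)) :
    HasCauchyGerm a μ := by
  obtain ⟨V, hV, -, hVs⟩ := exists_analyticAt_of_coeff ha (C := A) hA (fun γ hγ => by
    have := he γ hγ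
    rwa [Real.rpow_add hA, Real.rpow_one, mul_comm] at this)
  obtain ⟨L, hL⟩ := eventually_re_iff.1 hVs
  obtain ⟨L₀, hL₀⟩ := (Real.tendsto_exp_atTop.eventually_gt_atTop (c * A)).exists
  have hφV : ∀ w : ℂ, max L L₀ < w.re → -Real.pi < w.im → w.im < 0 →
      φ (Complex.exp w) = Complex.exp w * V (expPoint a w) := by
    intro w hw h1 h2
    have hmem : Complex.exp w ∈ lowerOutside (c * A) := by
      refine ⟨im_exp_neg h1 h2, ?_⟩
      rw [Complex.norm_exp]
      exact hL₀.trans (Real.exp_lt_exp.2 ((le_max_right _ _).trans_lt hw))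
    refine (hsum _ hmem).unique ?_
    simp only [div_cpow_eq (Complex.exp_ne_zero w),
      Complex.log_exp h1 (h2.le.trans Real.pi_pos.le)]
    exact (hL w ((le_max_left _ _).trans_lt hw)).mul_left _
  have hV0 : V 0 = 0 := voiculescuTransform_germ_zero ha μ hφ hV.continuousAt hφV
  obtain ⟨-, η, M, η', M', hη, hM, hη', hM', -, -, hinv⟩ := hφ
  let E : (ι → ℂ) → ℂ := fun s => 1 + V s
  have hE : AnalyticAt ℂ E 0 := analyticAt_const.add hV
  have hE0 : E 0 = 1 := by simp [E, hV0]
  obtain ⟨U, hU, hU0, hUiff⟩ := exists_analyticAt_inversion a hE hE0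
  obtain ⟨ε, hε, hcone⟩ := exists_mul_mem_truncatedCone hη
  have hs := tendsto_expPoint ha
  have hUs : Tendsto (fun w => U (expPoint a w)) (comap Complex.re atTop) (𝓝 0) := by
    rw [← hU0]; exact hU.continuousAt.tendsto.comp hs
  have hexpU : Tendsto (fun w => Complex.exp (U (expPoint a w)) - 1)
      (comap Complex.re atTop) (𝓝 0) := by
    have := ((Complex.continuous_exp.tendsto 0).comp hUs).sub_const 1
    simpa using this
  -- Here `U` solves `ζ + φ ζ = exp w` for `ζ = exp (w + U)`, so the reciprocal Cauchy transform at
  -- `exp w` is `ζ`, and `exp (-U)` is the germ.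
  let g : (ι → ℂ) → ℂ := fun s => Complex.exp (-U s)
  have hg : AnalyticAt ℂ g 0 := hU.neg.cexp
  obtain ⟨L₁, hL₁⟩ := eventually_re_iff.1 ((tendsto_pair_comap hUiff hs hUs).and
    ((hUs.eventually (Metric.ball_mem_nhds _ one_pos)).and
      (hexpU.eventually (Metric.ball_mem_nhds _ hε))))
  obtain ⟨L₂, hL₂⟩ := continuousOn_comp_expPoint ha hg
  set X := max (max L L₀ + 1) (max L₁ L₂) with hX
  have x0 : max L L₀ + 1 ≤ X := le_max_left _ _
  have x1 : L₁ ≤ X := (le_max_left _ _).trans (le_max_right _ _)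
  have x2 : L₂ ≤ X := (le_max_right _ _).trans (le_max_right _ _)
  have hlocal : ∀ w : ℂ, X < w.re → -Real.pi < w.im → w.im < 0 →
      Complex.exp w ∈ truncatedCone (2 * η) (2 * M) →
      cauchyTransform μ (Complex.exp w) = Complex.exp (-w) * g (expPoint a w) := by
    intro w hre him1 him2 hz
    obtain ⟨hiff, hu1, hv1⟩ := hL₁ w (x1.trans_lt hre)
    rw [dist_zero_right] at hu1 hv1
    set u := U (expPoint a w) with hu
    have hmem : Complex.exp (w + u) ∈ truncatedCone η M := by
      rw [Complex.exp_add]; exact hcone M _ _ hM hz hv1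
    have b1 := abs_lt.1 ((Complex.abs_im_le_norm u).trans_lt hu1)
    have b2 := abs_lt.1 ((Complex.abs_re_le_norm u).trans_lt hu1)
    have hpi := Real.pi_gt_three
    obtain ⟨i1, i2⟩ := im_mem_Ioo_of_im_exp_neg (w := w + u)
      (by rw [Complex.add_im]; linarith [b1.1]) (by rw [Complex.add_im]; linarith [b1.2])
      (truncatedCone_im_neg hM hmem)
    have hre' : max L L₀ < (w + u).re := by rw [Complex.add_re]; linarith [b2.1]
    have h1 : Complex.exp (w + u) + φ (Complex.exp (w + u)) = Complex.exp w := by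
      have h2 := hiff.2 rfl
      simp only at h2
      have h3 : Complex.exp (w + u) + φ (Complex.exp (w + u)) =
          Complex.exp w * (Complex.exp u * E (expPoint a (w + u))) := by
        rw [hφV _ hre' i1 i2, Complex.exp_add]; simp only [E]; ring
      rw [h3, expPoint_add, h2, mul_one]
    have h4 := (hinv _ hmem).2
    rw [h1, reciprocalCauchy] at h4
    have h5 : cauchyTransform μ (Complex.exp w) = (Complex.exp (w + u))⁻¹ := by
      rw [← h4, one_div, inv_inv]
    rw [h5, ← Complex.exp_neg, ← Complex.exp_add, neg_add]
  -- The inverse relation is known only in a cone. Both sides are holomorphic on this convex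
  -- half-strip, so the identity theorem extends the formula up to the real directions.
  let T : Set ℂ := {w | X < w.re} ∩ ({w | -Real.pi < w.im} ∩ {w | w.im < 0})
  have hTo : IsOpen T := (isOpen_lt continuous_const Complex.continuous_re).inter
    ((isOpen_lt continuous_const Complex.continuous_im).inter
      (isOpen_lt Complex.continuous_im continuous_const))
  have hTc : Convex ℝ T := (convex_halfSpace_re_gt X).inter
    ((convex_halfSpace_im_gt _).inter (convex_halfSpace_im_lt _))
  have hA1 : AnalyticOnNhd ℂ (fun w => cauchyTransform μ (Complex.exp w)) T := fun w hw =>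
    AnalyticAt.fun_comp (analyticAt_cauchyTransform μ (im_exp_neg hw.2.1 hw.2.2))
      analyticAt_cexp
  have hA2 : AnalyticOnNhd ℂ (fun w => Complex.exp (-w) * g (expPoint a w)) T := by
    refine DifferentiableOn.analyticOnNhd (DifferentiableOn.mul (by fun_prop) (hL₂.mono ?_)) hTo
    exact fun w hw => x2.trans_lt hw.1
  obtain ⟨x, hx1, hx2⟩ := ((eventually_gt_atTop X).and
    (Real.tendsto_exp_atTop.eventually_gt_atTop (2 * M))).exists
  set w₀ : ℂ := x - Real.pi / 2 * Complex.I with hw₀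
  have hw₀T : w₀ ∈ T := by
    refine ⟨?_, ?_, ?_⟩
    · simpa [w₀] using hx1
    · simp [w₀]; linarith [Real.pi_pos]
    · simp [w₀]; linarith [Real.pi_pos]
  have hnear : (fun w => cauchyTransform μ (Complex.exp w)) =ᶠ[𝓝 w₀]
      fun w => Complex.exp (-w) * g (expPoint a w) := by
    have hco : IsOpen (truncatedCone (2 * η) (2 * M)) :=
      (isOpen_lt Complex.continuous_im continuous_const).inter
        (isOpen_lt Complex.continuous_im
          (continuous_const.mul Complex.continuous_re.abs).neg)
    filter_upwards [hTo.mem_nhds hw₀T, (hco.preimage Complex.continuous_exp).mem_nhds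
      (exp_sub_pi_div_two_mem_truncatedCone hx2)] with w hw hw'
    exact hlocal w hw.1 hw.2.1 hw.2.2 hw'
  have hEq := hA1.eqOn_of_preconnected_of_eventuallyEq hA2 hTc.isPreconnected hw₀T hnear
  exact ⟨g, hg, by simp [g, hU0], X, fun w h1 h2 h3 => hEq ⟨h1, h2, h3⟩⟩

end

/-! ### Assembly. -/

/-- The integer part is treated as one more generator, indexed by `none` and equal to `1`. -/
theorem genSemigroup_eq_natSpan {p : ℕ} (α : Fin p → ℝ) :
    genSemigroup α = natSpan fun o : Option (Fin p) => o.elim 1 α := by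
  ext γ
  constructor
  · rintro ⟨n₀, n, rfl⟩
    exact ⟨fun o => o.elim n₀ n, by simp [Fintype.sum_option]⟩
  · rintro ⟨n, rfl⟩
    exact ⟨n none, fun i => n (some i), by simp [Fintype.sum_option]⟩

end PowerSeriesTail

end

theorem theorem3p5 (p : ℕ) (hp : 1 ≤ p) (α : Fin p → ℝ) (hα_pos : ∀ i, 0 < α i)
    (hα_mono : StrictMono α) (c : ℝ)
    (hc : PowerSeriesTail.IsGrowthConstant (PowerSeriesTail.genSemigroup α) c)
    (μ : MeasureTheory.Measure ℝ) [MeasureTheory.IsProbabilityMeasure μ] :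
    PowerSeriesTail.MemP (PowerSeriesTail.genSemigroup α) c μ ↔
      ∃ (e : ℝ → ℂ) (A : ℝ), 0 < A ∧
        (∀ γ ∈ PowerSeriesTail.genSemigroup α, ‖e γ‖ ≤ A ^ (γ + 1)) ∧
        ∃ φ : ℂ → ℂ,
          PowerSeriesTail.IsVoiculescuTransform μ (PowerSeriesTail.lowerOutside (c * A)) φ ∧
          ∀ z ∈ PowerSeriesTail.lowerOutside (c * A),
            HasSum (fun γ : PowerSeriesTail.genSemigroup α =>
              z * (e γ / z ^ (((γ : ℝ) : ℂ)))) (φ z) := by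
  have ha : ∀ o : Option (Fin p), 0 < o.elim 1 α := by
    rintro (_ | i)
    · exact one_pos
    · exact hα_pos i
  rw [PowerSeriesTail.genSemigroup_eq_natSpan] at hc ⊢
  constructor
  · intro h
    exact PowerSeriesTail.exists_voiculescuTransform_of_hasCauchyGerm ha hc.1 μ
      (PowerSeriesTail.hasCauchyGerm_of_memP ha (o := none) rfl hc μ h)
  · rintro ⟨e, A, hA, he, φ, hφ, hsum⟩
    exact PowerSeriesTail.memP_of_hasCauchyGerm ha hc.1 μ
      (PowerSeriesTail.hasCauchyGerm_of_voiculescuTransform ha hA μ he hφ hsum)
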